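/- **Formulas.** Let $n=2^{\ell}$ be a power of two, $k\ge 2$, and let $G$ be a $k$-partite graph on $k$ blocks of $n$ vertices each (edges only between distinct blocks). $\mathrm{Bin\text{-}Clique}^n_k(G)$ is the CNF in the variables $\omega_{i,j}$ ($i\in[k]$, $j\in[\log n]$) with one clause $\bigvee_{t}\omega_{i,t}^{1-a_t}\vee\bigvee_{t}\omega_{j,t}^{1-b_t}$ for all distinct blocks $i\ne j$ and all vertices $a$ of block $i$ and $b$ of block $j$ that are not adjacent; here $a_1\dots a_{\log n}$ and $b_1\dots b_{\log n}$ are the binary expansions of $a,b$, $\omega^1=\omega$, $\omega^0=\neg\omega$, and logarithms are to base 2. **Proof system.** $\mathrm{Res}(s)$ is the refutation system working with disjunctions of conjunctions of at most $s$ literals ($s$-DNFs), whose rules are: $\wedge$-introduction (from $D_1\vee\bigwedge A$ and $D_2\vee\bigwedge B$ infer $D_1\vee D_2\vee\bigwedge(A\cup B)$, if $|A\cup B|\le s$); cut (from $D_1\vee\bigvee_{l\in J}l$ and $D_2\vee\bigwedge_{l\in J}\neg l$ infer $D_1\vee D_2$); weakening (from $D$ infer $D\vee\bigwedge A$ if $|A|\le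 s$, and from $D\vee\bigwedge(A\cup B)$ infer $D\vee\bigwedge A$). The size of a refutation is its number of rule applications. **Parameters.** Put $\delta=\frac1{2\cdot 96^2}$, $\mathrm{pe}(s)=2^{s^2+3s}$ and $\mathrm{de}(s)=(\mathrm{pe}(s)\,s)^s$. For $0<\epsilon<1$ let $\mathcal G^n_{k,\epsilon}(p)$ be the random graph on $k$ blocks of $n$ vertices in which each pair of vertices from distinct blocks is independently an edge with probability $p=n^{-(1+\epsilon)\frac{2}{k-1}}$. Say that $\mathrm{Clique}(G,s,k)$ holds if for every partial assignment $\rho$ that assigns exactly $\lfloor 2^{-(s+1)}\log n\rfloor$ variables in each block, the restricted formula $\mathrm{Bin\text{-}Clique}^n_k(G){\upharpoonright_\rho}$ has no $\mathrm{Res}(s)$ refutation of size less than $n^{\delta(k-1)/\mathrm{de}(s)}$. **Theorem.** 1. There is an absolute constant $c>0$ such that the following holds. Let $0<\epsilon<1$, let $n$ be a power of two, and let $s\ge1$ and $k\ge 2$ be integers with $s\le\left(\frac15\log\log n\right)^{1/3}$ and $k\le\log n$. Then with positive probability a random graph $G\sim\mathcal G^n_{k,\epsilon}(p)$ is a $k$-partite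 graph without a $k$-clique such that $\mathrm{Clique}(G,s,k)$ holds and every $\mathrm{Res}(s)$ refutation of $\mathrm{Bin\text{-}Clique}^n_k(G)$ has size at least $n^{\delta(k-1)/\mathrm{de}(s)}$ and at least $n^{ck/\mathrm{de}(s)}$. In particular such a graph exists. 2. For all fixed integers $s\ge1$ and $k\ge2$ the bound $n^{\delta(k-1)/\mathrm{de}(s)}$ is of the form $g(n)^k$ with $g$ strictly increasing in $n$. 3. For every fixed $s\ge 1$ fpt-size refutations are impossible: for every function $f:\mathbb N\to\mathbb N$ and every real $d$ there is $k\ge2$ such that for all sufficiently large powers of two $n$ there is a $k$-partite graph $G$ on $k$ blocks of $n$ vertices, without a $k$-clique, such that every $\mathrm{Res}(s)$ refutation of $\mathrm{Bin\text{-}Clique}^n_k(G)$ has size greater than $f(k)\,n^{d}$. -/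

import Mathlib

/-! ### Literals, clauses, `s`-DNFs and the refutation system `Res(s)` -/

/-- A literal over the variables `V`: `(x, true)` is `x` and `(x, false)` is `¬ x`. -/
abbrev Lit (V : Type) := V × Bool

/-- The complementary literal. -/
def Lit.neg {V : Type} (l : Lit V) : Lit V := (l.1, !l.2)

/-- A clause: the disjunction of its literals. -/
abbrev Clause (V : Type) := Finset (Lit V)

/-- A term: the conjunction of its literals (the empty term is `⊤`). -/
abbrev Term (V : Type) := Finset (Lit V)

/-- A DNF: the disjunction of its terms (the empty DNF is the empty clause `⊥`). -/
abbrev DNF (V : Type) := Finset (Term V)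

/-- A clause, seen as a DNF all of whose terms are single literals. -/
def Clause.toDNF {V : Type} [DecidableEq V] (C : Clause V) : DNF V :=
  C.image fun l => {l}

/-- `ResRule s Ps D`: the DNF `D` follows from the list of premises `Ps` by one application of a
derivation rule of `Res(s)`. -/
inductive ResRule {V : Type} [DecidableEq V] (s : ℕ) : List (DNF V) → DNF V → Prop
  /-- From `D₁ ∨ ⋀ A` and `D₂ ∨ ⋀ B` infer `D₁ ∨ D₂ ∨ ⋀ (A ∪ B)`, if `|A ∪ B| ≤ s`. -/
  | andIntro (D₁ D₂ : DNF V) (A B : Term V) (h : (A ∪ B).card ≤ s) :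
      ResRule s [insert A D₁, insert B D₂] (insert (A ∪ B) (D₁ ∪ D₂))
  /-- From `D₁ ∨ ⋁_{l ∈ J} l` and `D₂ ∨ ⋀_{l ∈ J} ¬ l` infer `D₁ ∨ D₂`. -/
  | cut (D₁ D₂ : DNF V) (J : Finset (Lit V)) :
      ResRule s [D₁ ∪ J.image (fun l => {l}), insert (J.image Lit.neg) D₂] (D₁ ∪ D₂)
  /-- From `D` infer `D ∨ ⋀ A`, if `|A| ≤ s`. -/
  | weaken (D : DNF V) (A : Term V) (h : A.card ≤ s) :
      ResRule s [D] (insert A D)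
  /-- From `D ∨ ⋀ (A ∪ B)` infer `D ∨ ⋀ A`. -/
  | shrink (D : DNF V) (A B : Term V) :
      ResRule s [insert (A ∪ B) D] (insert A D)

/-- `ResDerivation s F π`: the list `π` (latest line first) is a `Res(s)` derivation from the CNF
`F`. Every line is inferred by one rule whose premises are clauses of `F` or earlier lines; the
clauses of `F` themselves are not listed, so `π.length` is the number of rule applications, that
is, the number of internal nodes of the derivation DAG. -/
inductive ResDerivation {V : Type} [DecidableEq V] (s : ℕ) (F : Set (Clause V)) :
    List (DNF V) → Prop
  | nil : ResDerivation s F []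
  | cons (π : List (DNF V)) (Ps : List (DNF V)) (D : DNF V) (hπ : ResDerivation s F π)
      (hPs : ∀ P ∈ Ps, (∃ C ∈ F, P = C.toDNF) ∨ P ∈ π) (hD : ResRule s Ps D) :
      ResDerivation s F (D :: π)

/-- A `Res(s)` refutation of `F`: a derivation of the empty clause. Its size is `π.length`. -/
def IsResRefutation {V : Type} [DecidableEq V] (s : ℕ) (F : Set (Clause V))
    (π : List (DNF V)) : Prop :=
  ResDerivation s F π ∧ (∅ ∈ F ∨ ∅ ∈ π)

/-- The restriction of the CNF `F` by the partial assignment `ρ`: clauses with a satisfied literal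
are deleted, and falsified literals are deleted from the remaining clauses. -/
def restrictCNF {V : Type} (F : Set (Clause V)) (ρ : V → Option Bool) : Set (Clause V) :=
  {C' | ∃ C ∈ F, (∀ l ∈ C, ρ l.1 ≠ some l.2) ∧ C' = C.filter fun l => ρ l.1 = none}

/-! ### Binary clique formulas -/

/-- The variables `ω_{i,j}`: bit `j` of the vertex chosen in block `i`. -/
abbrev BinVar (k ℓ : ℕ) := Fin k × Fin ℓ

/-- The clause saying that the vertex chosen in block `i` is not the vertex `a`: the disjunction
over all bit positions `j` of the literal `ω_{i,j}^{1 - a_j}`. -/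
def notVertex {k ℓ : ℕ} (i : Fin k) (a : Fin (2 ^ ℓ)) : Clause (BinVar k ℓ) :=
  Finset.univ.image fun j : Fin ℓ => ((i, j), !(Nat.testBit a.val j.val))

/-- The formula `Bin-Clique` of a graph with `k` blocks of `n = 2 ^ ℓ` vertices: one clause for
each pair of non-adjacent vertices from distinct blocks. -/
def binClique {k ℓ : ℕ} (G : SimpleGraph (Fin k × Fin (2 ^ ℓ))) : Set (Clause (BinVar k ℓ)) :=
  {C | ∃ (i j : Fin k) (a b : Fin (2 ^ ℓ)), i ≠ j ∧ ¬ G.Adj (i, a) (j, b) ∧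
    C = notVertex i a ∪ notVertex j b}

/-- A partial assignment is `β`-total if it assigns exactly `⌊β log n⌋` bits in each block. -/
def IsTotalRestriction {k ℓ : ℕ} (β : ℝ) (ρ : BinVar k ℓ → Option Bool) : Prop :=
  ∀ b : Fin k, (Finset.univ.filter fun j : Fin ℓ => ρ (b, j) ≠ none).card = ⌊β * (ℓ : ℝ)⌋₊

/-- `p(s) = 2 ^ (s² + 3 s)`. -/
def pe (s : ℕ) : ℕ := 2 ^ (s ^ 2 + 3 * s)

/-- The doubly exponential function `d(s) = (p(s) s) ^ s`. -/
def de (s : ℕ) : ℕ := (pe s * s) ^ s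

/-- The size bound `n ^ (δ (k - 1) / d(s))` with `δ = 1 / (2 · 96²)`. -/
noncomputable def sizeBound (n k s : ℕ) : ℝ :=
  (n : ℝ) ^ ((1 / (2 * 96 ^ 2) : ℝ) * ((k : ℝ) - 1) / (de s : ℝ))

/-- Property `Clique(G, s, k)`: for every `1 / 2 ^ (s + 1)`-total restriction `ρ`, the restricted
formula has no `Res(s)` refutation of size less than `n ^ (δ (k - 1) / d(s))`. -/
def CliqueProperty {k ℓ : ℕ} (G : SimpleGraph (Fin k × Fin (2 ^ ℓ))) (s : ℕ) : Prop :=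
  ∀ ρ : BinVar k ℓ → Option Bool, IsTotalRestriction (1 / 2 ^ (s + 1)) ρ →
    ∀ π, IsResRefutation s (restrictCNF (binClique G) ρ) π →
      sizeBound (2 ^ ℓ) k s ≤ (π.length : ℝ)

/-! ### Random block graphs -/

/-- The law of the random graph on `k` blocks of `n` vertices in which every pair of vertices from
distinct blocks is an edge with probability `p`, independently, and there are no other edges. -/
noncomputable def randomBlockGraph (k n : ℕ) (p : unitInterval) :
    MeasureTheory.Measure (SimpleGraph (Fin k × Fin n)) :=
  (ProbabilityTheory.setBernoulli (SimpleGraph.completeEquipartiteGraph k n).edgeSet p).map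
    SimpleGraph.fromEdgeSet

/-! ### Semantics of DNFs and soundness of `Res(s)` -/

/-! Positive probability only asks for one graph: since `0 < p < 1`, every graph below the complete
equipartite graph has positive mass (`randomBlockGraph_singleton_pos`). The witness is the explicit
`colorGraph`: a vertex is coloured by its number of ones modulo `k - 1`, and vertices of distinct
blocks are adjacent when their colours differ. A `k`-clique would need `k` colours out of `k - 1`.
Yet this obstruction is invisible locally: as long as a block has many free bits, its colour can
still be steered away from the few colours already in use.

The lower bound combines two facts. Switching (`exists_restriction_decDepth`): if a refutation is
short, some restriction leaves at least half of each block free and turns every line into a decision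
tree of small depth `h`. A DNF with many variable-disjoint terms is satisfied by a random
restriction; any other has a small set of variables meeting all its terms, and querying that set
lowers the width by one, so `s` rounds suffice. Adversary (`ResDerivation.not_falsified`): no line
with such a tree is falsified by a partial assignment that sets at most `h` further bits and keeps
the colours of the nearly full blocks distinct. The empty clause is falsified by the restriction
itself, so there is no short refutation.

This needs `k - 1` large compared with `de s`. Otherwise the claimed bound is at most `n`, and a
count of falsified axioms suffices (`IsResRefutation.two_pow_le`). Both arguments start from an
arbitrary restriction setting few bits per block, which covers `CliqueProperty` and the unrestricted
formula together (`sizeBound_le_length`). -/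

/-- The term `T` is true at the total assignment `x`. -/
def TermTrue {V : Type} (T : Term V) (x : V → Bool) : Prop := ∀ l ∈ T, x l.1 = l.2

/-- The DNF `D` is true at the total assignment `x`. -/
def DNFTrue {V : Type} (D : DNF V) (x : V → Bool) : Prop := ∃ T ∈ D, TermTrue T x

/-- The total assignment `x` extends the partial assignment `τ`. -/
def Agrees {V : Type} (x : V → Bool) (τ : V → Option Bool) : Prop :=
  ∀ v b, τ v = some b → x v = b

/-- The partial assignment `τ'` extends the partial assignment `τ`. -/
def Extends {V : Type} (τ τ' : V → Option Bool) : Prop :=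
  ∀ v b, τ v = some b → τ' v = some b

theorem Extends.refl {V : Type} (τ : V → Option Bool) : Extends τ τ := fun _ _ h => h

theorem Extends.trans {V : Type} {τ₁ τ₂ τ₃ : V → Option Bool} (h₁ : Extends τ₁ τ₂)
    (h₂ : Extends τ₂ τ₃) : Extends τ₁ τ₃ := fun v b h => h₂ v b (h₁ v b h)

theorem Agrees.of_extends {V : Type} {x : V → Bool} {τ τ' : V → Option Bool} (h : Agrees x τ')
    (hτ : Extends τ τ') : Agrees x τ := fun v b hv => h v b (hτ v b hv)

theorem Extends.ne_none {V : Type} {τ τ' : V → Option Bool} (h : Extends τ τ') {v : V}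
    (hv : τ v ≠ none) : τ' v ≠ none := by
  obtain ⟨b, hb⟩ := Option.ne_none_iff_exists'.1 hv
  rw [h v b hb]; simp

theorem extends_update {V : Type} [DecidableEq V] {τ : V → Option Bool} {v : V} (hv : τ v = none)
    (b : Bool) : Extends τ (Function.update τ v (some b)) := by
  intro w c hw
  have : w ≠ v := by rintro rfl; simp [hv] at hw
  rwa [Function.update_of_ne this]

theorem update_extends {V : Type} [DecidableEq V] {τ τ' : V → Option Bool} {v : V} {b : Bool}
    (h : Extends τ τ') (hv : τ' v = some b) : Extends (Function.update τ v (some b)) τ' := by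
  intro w c hw
  by_cases hwv : w = v
  · subst hwv; simp at hw; rw [hv, hw]
  · rw [Function.update_of_ne hwv] at hw; exact h w c hw

theorem update_extends_update {V : Type} [DecidableEq V] {τ τ' : V → Option Bool}
    (h : Extends τ τ') (v : V) (b : Bool) :
    Extends (Function.update τ v (some b)) (Function.update τ' v (some b)) := by
  intro w c hw
  by_cases hwv : w = v
  · subst hwv; simpa using hw
  · rw [Function.update_of_ne hwv] at hw ⊢; exact h w c hw

theorem Agrees.update {V : Type} [DecidableEq V] {x : V → Bool} {τ : V → Option Bool}
    (h : Agrees x τ) (v : V) : Agrees x (Function.update τ v (some (x v))) := by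
  intro w c hw
  by_cases hwv : w = v
  · subst hwv; simpa using hw
  · rw [Function.update_of_ne hwv] at hw; exact h w c hw

theorem exists_agrees {V : Type} (τ : V → Option Bool) : ∃ x : V → Bool, Agrees x τ :=
  ⟨fun v => (τ v).getD false, fun v b h => by simp [h]⟩

theorem dnfTrue_insert {V : Type} [DecidableEq V] {T : Term V} {D : DNF V} {x : V → Bool} :
    DNFTrue (insert T D) x ↔ TermTrue T x ∨ DNFTrue D x := by
  simp [DNFTrue]

theorem dnfTrue_union {V : Type} [DecidableEq V] {D₁ D₂ : DNF V} {x : V → Bool} :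
    DNFTrue (D₁ ∪ D₂) x ↔ DNFTrue D₁ x ∨ DNFTrue D₂ x := by
  simp only [DNFTrue, Finset.mem_union]
  grind

theorem termTrue_union {V : Type} [DecidableEq V] {A B : Term V} {x : V → Bool} :
    TermTrue (A ∪ B) x ↔ TermTrue A x ∧ TermTrue B x := by
  simp only [TermTrue, Finset.mem_union]
  grind

theorem dnfTrue_toDNF {V : Type} [DecidableEq V] {C : Finset (Lit V)} {x : V → Bool} :
    DNFTrue (C.image fun l => ({l} : Term V)) x ↔ ∃ l ∈ C, x l.1 = l.2 := by
  simp only [DNFTrue, TermTrue, Finset.exists_mem_image, Finset.mem_singleton, forall_eq]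

theorem not_dnfTrue_empty {V : Type} (x : V → Bool) : ¬ DNFTrue ∅ x := by simp [DNFTrue]

theorem ResRule.sound {V : Type} [DecidableEq V] {s : ℕ} {Ps : List (DNF V)} {D : DNF V}
    (h : ResRule s Ps D) {x : V → Bool} (hP : ∀ P ∈ Ps, DNFTrue P x) : DNFTrue D x := by
  cases h with
  | andIntro D₁ D₂ A B h =>
    simp only [List.mem_cons, List.not_mem_nil, or_false, forall_eq_or_imp, forall_eq,
      dnfTrue_insert, dnfTrue_union, termTrue_union] at hP ⊢
    tauto
  | cut D₁ D₂ J =>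
    simp only [List.mem_cons, List.not_mem_nil, or_false, forall_eq_or_imp, forall_eq,
      dnfTrue_insert, dnfTrue_union, dnfTrue_toDNF] at hP ⊢
    obtain ⟨h₁ | ⟨l, hl, hxl⟩, h₂ | h₂⟩ := hP
    · exact Or.inl h₁
    · exact Or.inl h₁
    · have := h₂ (Lit.neg l) (Finset.mem_image_of_mem _ hl)
      simp [Lit.neg, hxl] at this
    · exact Or.inr h₂
  | weaken D A h =>
    simp only [List.mem_cons, List.not_mem_nil, or_false, forall_eq, dnfTrue_insert] at hP ⊢
    exact Or.inr hP
  | shrink D A B =>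
    simp only [List.mem_cons, List.not_mem_nil, or_false, forall_eq, dnfTrue_insert,
      termTrue_union] at hP ⊢
    tauto

theorem ResRule.length_le {V : Type} [DecidableEq V] {s : ℕ} {Ps : List (DNF V)} {D : DNF V}
    (h : ResRule s Ps D) : Ps.length ≤ 2 := by
  cases h <;> simp

/-- Every line derived by a rule of `Res(s)` from `s`-DNFs is an `s`-DNF. -/
theorem ResRule.card_le {V : Type} [DecidableEq V] {s : ℕ} {Ps : List (DNF V)} {D : DNF V}
    (h : ResRule s Ps D) (hP : ∀ P ∈ Ps, ∀ T ∈ P, T.card ≤ s) : ∀ T ∈ D, T.card ≤ s := by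
  cases h with
  | andIntro D₁ D₂ A B h => simp at hP ⊢; grind
  | cut D₁ D₂ J =>
    simp only [List.mem_cons, List.not_mem_nil, or_false, forall_eq_or_imp, forall_eq] at hP
    intro T hT
    rcases Finset.mem_union.1 hT with hT | hT
    · exact hP.1 T (Finset.mem_union_left _ hT)
    · exact hP.2 T (Finset.mem_insert_of_mem hT)
  | weaken D A h => simp at hP ⊢; grind
  | shrink D A B =>
    simp only [List.mem_cons, List.not_mem_nil, or_false, forall_eq,
      Finset.forall_mem_insert] at hP ⊢
    exact ⟨(Finset.card_le_card Finset.subset_union_left).trans hP.1, hP.2⟩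

theorem ResDerivation.card_le {V : Type} [DecidableEq V] {s : ℕ} (hs : 1 ≤ s)
    {F : Set (Clause V)} {π : List (DNF V)} (h : ResDerivation s F π) :
    ∀ D ∈ π, ∀ T ∈ D, T.card ≤ s := by
  induction h with
  | nil => simp
  | cons π Ps D hπ hPs hD ih =>
    intro E hE
    rcases List.mem_cons.1 hE with rfl | hE
    · refine hD.card_le fun P hP => ?_
      rcases hPs P hP with ⟨C, -, rfl⟩ | hP
      · intro T hT
        obtain ⟨l, -, rfl⟩ := Finset.mem_image.1 hT
        simpa using hs
      · exact ih P hP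
    · exact ih E hE

/-! ### Decision trees -/

/-- The predicate `P` is constant on the total assignments extending `τ`. -/
def ConstOn {V : Type} (τ : V → Option Bool) (P : (V → Bool) → Prop) : Prop :=
  (∀ x, Agrees x τ → P x) ∨ ∀ x, Agrees x τ → ¬ P x

/-- Below `τ`, the predicate `P` is computed by a decision tree of depth at most `h`. -/
def DecDepth {V : Type} [DecidableEq V] : ℕ → (V → Option Bool) → ((V → Bool) → Prop) → Prop
  | 0, τ, P => ConstOn τ P
  | h + 1, τ, P => ConstOn τ P ∨
      ∃ v, τ v = none ∧ ∀ b, DecDepth h (Function.update τ v (some b)) P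

theorem ConstOn.mono {V : Type} {τ τ' : V → Option Bool} {P : (V → Bool) → Prop}
    (h : ConstOn τ P) (hτ : Extends τ τ') : ConstOn τ' P :=
  h.imp (fun h x hx => h x (hx.of_extends hτ)) fun h x hx => h x (hx.of_extends hτ)

theorem ConstOn.decDepth {V : Type} [DecidableEq V] {τ : V → Option Bool} {P : (V → Bool) → Prop}
    (h : ConstOn τ P) (n : ℕ) : DecDepth n τ P := by
  cases n with
  | zero => exact h
  | succ n => exact Or.inl h

theorem DecDepth.succ {V : Type} [DecidableEq V] {n : ℕ} {τ : V → Option Bool}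
    {P : (V → Bool) → Prop} (h : DecDepth n τ P) : DecDepth (n + 1) τ P := by
  induction n generalizing τ with
  | zero => exact Or.inl h
  | succ n ih =>
    rcases h with h | ⟨v, hv, h⟩
    · exact Or.inl h
    · exact Or.inr ⟨v, hv, fun b => ih (h b)⟩

theorem DecDepth.mono_depth {V : Type} [DecidableEq V] {m n : ℕ} {τ : V → Option Bool}
    {P : (V → Bool) → Prop} (h : DecDepth m τ P) (hmn : m ≤ n) : DecDepth n τ P := by
  induction hmn with
  | refl => exact h
  | step _ ih => exact ih.succ

theorem DecDepth.mono {V : Type} [DecidableEq V] {n : ℕ} {τ τ' : V → Option Bool}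
    {P : (V → Bool) → Prop} (h : DecDepth n τ P) (hτ : Extends τ τ') : DecDepth n τ' P := by
  induction n generalizing τ τ' with
  | zero => exact ConstOn.mono h hτ
  | succ n ih =>
    rcases h with h | ⟨v, hv, h⟩
    · exact Or.inl (h.mono hτ)
    · rcases hv' : τ' v with _ | b
      · exact Or.inr ⟨v, hv', fun b => ih (h b) (update_extends_update hτ v b)⟩
      · exact (ih (h b) (update_extends hτ hv')).succ

theorem DecDepth.congr {V : Type} [DecidableEq V] {n : ℕ} {τ : V → Option Bool}
    {P Q : (V → Bool) → Prop} (h : DecDepth n τ P) (hPQ : ∀ x, Agrees x τ → (P x ↔ Q x)) :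
    DecDepth n τ Q := by
  have hc : ∀ τ, ConstOn τ P → (∀ x, Agrees x τ → (P x ↔ Q x)) → ConstOn τ Q :=
    fun τ h e => h.imp (fun h x hx => (e x hx).1 (h x hx)) fun h x hx => (e x hx).not.1 (h x hx)
  induction n generalizing τ with
  | zero => exact hc τ h hPQ
  | succ n ih =>
    rcases h with h | ⟨v, hv, h⟩
    · exact Or.inl (hc τ h hPQ)
    · exact Or.inr ⟨v, hv, fun b =>
        ih (h b) fun x hx => hPQ x (hx.of_extends (extends_update hv b))⟩

/-- Query all variables of `W` first. -/
theorem DecDepth.query {V : Type} [DecidableEq V] {n : ℕ} {P : (V → Bool) → Prop} (W : Finset V)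
    {τ : V → Option Bool}
    (h : ∀ τ', Extends τ τ' → (∀ w ∈ W, τ' w ≠ none) → DecDepth n τ' P) :
    DecDepth (n + W.card) τ P := by
  induction W using Finset.induction_on generalizing τ with
  | empty => simpa using h τ (Extends.refl τ)
  | insert v W hvW ih =>
    rw [Finset.card_insert_of_notMem hvW, ← add_assoc]
    by_cases hv : τ v = none
    · refine Or.inr ⟨v, hv, fun b => ih fun τ' hτ' hW => ?_⟩
      refine h τ' ((extends_update hv b).trans hτ') (Finset.forall_mem_insert _ _ _ |>.2 ⟨?_, hW⟩)
      exact hτ'.ne_none (by simp)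
    · refine (ih fun τ' hτ' hW => ?_).succ
      exact h τ' hτ' (Finset.forall_mem_insert _ _ _ |>.2 ⟨hτ'.ne_none hv, hW⟩)

/-! ### Restricting DNFs -/

/-- A term is consistent if it has no two distinct literals of the same variable. -/
def TermConsistent {V : Type} (T : Term V) : Prop := Set.InjOn Prod.fst (T : Set (Lit V))

open Classical in
/-- The restriction of a DNF by a partial assignment: inconsistent and falsified terms are
deleted, and so are the satisfied literals of the remaining terms. -/
noncomputable def restrictDNF {V : Type} (D : DNF V) (α : V → Option Bool) : DNF V :=
  (D.filter fun T => TermConsistent T ∧ ∀ l ∈ T, α l.1 ≠ some !l.2).image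
    fun T => T.filter fun l => α l.1 = none

theorem TermTrue.consistent {V : Type} {T : Term V} {x : V → Bool} (h : TermTrue T x) :
    TermConsistent T := by
  intro l hl m hm hlm
  refine Prod.ext hlm ?_
  rw [← h l hl, ← h m hm, hlm]

theorem mem_restrictDNF {V : Type} {D : DNF V} {α : V → Option Bool} {T : Term V} :
    T ∈ restrictDNF D α ↔ ∃ S ∈ D, TermConsistent S ∧ (∀ l ∈ S, α l.1 ≠ some !l.2) ∧
      T = S.filter fun l => α l.1 = none := by
  simp only [restrictDNF, Finset.mem_image, Finset.mem_filter]
  constructor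
  · rintro ⟨S, ⟨h₁, h₂, h₃⟩, rfl⟩
    exact ⟨S, h₁, h₂, h₃, by congr⟩
  · rintro ⟨S, h₁, h₂, h₃, rfl⟩
    exact ⟨S, ⟨h₁, h₂, h₃⟩, by congr⟩

theorem dnfTrue_restrictDNF {V : Type} {D : DNF V} {α : V → Option Bool} {x : V → Bool}
    (hx : Agrees x α) : DNFTrue (restrictDNF D α) x ↔ DNFTrue D x := by
  constructor
  · rintro ⟨T, hT, hTx⟩
    obtain ⟨S, hS, -, hα, rfl⟩ := mem_restrictDNF.1 hT
    refine ⟨S, hS, fun l hl => ?_⟩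
    rcases hl' : α l.1 with _ | b
    · exact hTx l (Finset.mem_filter.2 ⟨hl, hl'⟩)
    · rw [hx _ _ hl']
      have := hα l hl
      rw [hl'] at this
      revert this
      cases b <;> cases l.2 <;> simp
  · rintro ⟨S, hS, hSx⟩
    refine ⟨_, mem_restrictDNF.2 ⟨S, hS, hSx.consistent, fun l hl h => ?_, rfl⟩,
      fun l hl => hSx l (Finset.mem_filter.1 hl).1⟩
    have h₁ := hx _ _ h
    rw [hSx l hl] at h₁
    simp at h₁

/-- Two terms share no variable. -/
def TermDisjoint {V : Type} (S T : Term V) : Prop := ∀ l ∈ S, ∀ m ∈ T, l.1 ≠ m.1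

/-- A DNF has many pairwise variable-disjoint terms or few variables that meet all its terms. -/
theorem disjoint_terms_or_cover {V : Type} [DecidableEq V] {j : ℕ} {D : DNF V}
    (hD : ∀ T ∈ D, T.card ≤ j + 1) (m : ℕ) :
    (∃ S ⊆ D, (S : Set (Term V)).Pairwise TermDisjoint ∧ m ≤ S.card) ∨
      ∃ W : Finset V, W.card ≤ m * (j + 1) ∧ ∀ T ∈ D, T.Nonempty → ∃ l ∈ T, l.1 ∈ W := by
  classical
  -- By maximality of a disjoint family, the variables of its terms meet every nonempty term of `D`.
  obtain ⟨S, hS⟩ := (D.powerset.filter fun S : DNF V =>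
    (S : Set (Term V)).Pairwise TermDisjoint).exists_maximal ⟨∅, by simp⟩
  have hS₁ := Finset.mem_filter.1 hS.1
  rw [Finset.mem_powerset] at hS₁
  by_cases hm : m ≤ S.card
  · exact Or.inl ⟨S, hS₁.1, hS₁.2, hm⟩
  right
  refine ⟨S.biUnion fun T => T.image Prod.fst, ?_, fun T hT hne => ?_⟩
  · refine (Finset.card_biUnion_le_card_mul _ _ (j + 1) fun T hT => ?_).trans
      (Nat.mul_le_mul_right _ (not_le.1 hm).le)
    exact Finset.card_image_le.trans (hD T (hS₁.1 hT))
  · by_contra! hW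
    have hdis : ∀ U ∈ S, TermDisjoint T U := fun U hU l hl m hm e =>
      hW l hl (Finset.mem_biUnion.2 ⟨U, hU, Finset.mem_image.2 ⟨m, hm, e.symm⟩⟩)
    have hins : insert T S ∈ D.powerset.filter fun S : DNF V =>
        (S : Set (Term V)).Pairwise TermDisjoint := by
      refine Finset.mem_filter.2 ⟨Finset.mem_powerset.2 (Finset.insert_subset hT hS₁.1), ?_⟩
      rw [Finset.coe_insert]
      refine hS₁.2.insert fun U hU _ => ⟨hdis U hU, fun l hl m hm e => hdis U hU m hm l hl e.symm⟩
    have hTS : T ∈ S := hS.2 hins (Finset.subset_insert T S) (Finset.mem_insert_self T S)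
    obtain ⟨l, hl⟩ := hne
    exact hdis T hTS l hl l hl rfl

/-- The partial assignment with domain `W` that is true exactly on `A`. -/
def setOn {V : Type} [DecidableEq V] (W A : Finset V) : V → Option Bool :=
  fun v => if v ∈ W then some (decide (v ∈ A)) else none

theorem card_restrictDNF_setOn {V : Type} [DecidableEq V] {j : ℕ} {D : DNF V}
    (hD : ∀ T ∈ D, T.card ≤ j + 1) {W : Finset V}
    (hW : ∀ T ∈ D, T.Nonempty → ∃ l ∈ T, l.1 ∈ W) (A : Finset V) :
    ∀ T ∈ restrictDNF D (setOn W A), T.card ≤ j := by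
  intro T hT
  obtain ⟨S, hS, -, -, rfl⟩ := mem_restrictDNF.1 hT
  rcases S.eq_empty_or_nonempty with rfl | hne
  · simp
  obtain ⟨l, hl, hlW⟩ := hW S hS hne
  refine Nat.lt_succ_iff.1 ((Finset.card_lt_card ?_).trans_le (hD S hS))
  refine Finset.filter_ssubset.2 ⟨l, hl, by simp [setOn, hlW]⟩

theorem card_restrictDNF {V : Type} {j : ℕ} {D : DNF V} (hD : ∀ T ∈ D, T.card ≤ j)
    (α : V → Option Bool) : ∀ T ∈ restrictDNF D α, T.card ≤ j := by
  intro T hT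
  obtain ⟨S, hS, -, -, rfl⟩ := mem_restrictDNF.1 hT
  exact (Finset.card_filter_le _ _).trans (hD S hS)

/-! ### Random restrictions -/

/-- The number of variables of block `b` that `τ` assigns. -/
def blockCount {k ℓ : ℕ} (τ : BinVar k ℓ → Option Bool) (b : Fin k) : ℕ :=
  (Finset.univ.filter fun j : Fin ℓ => τ (b, j) ≠ none).card

/-- A variable is assigned with probability `q`, to a uniformly random value. -/
noncomputable def bitWeight (q : ℝ) : Option Bool → ℝ
  | none => 1 - q
  | some _ => q / 2

/-- The probability of the partial assignment `τ`, if the variables are independent. -/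
noncomputable def restrictionWeight {V : Type} [Fintype V] (q : ℝ) (τ : V → Option Bool) : ℝ :=
  ∏ v, bitWeight q (τ v)

theorem restrictionWeight_nonneg {V : Type} [Fintype V] {q : ℝ} (h₀ : 0 ≤ q) (h₁ : q ≤ 1)
    (τ : V → Option Bool) : 0 ≤ restrictionWeight q τ := by
  refine Finset.prod_nonneg fun v _ => ?_
  rcases τ v with _ | b <;> simp [bitWeight] <;> linarith

theorem sum_restrictionWeight_mul_prod {V : Type} [Fintype V] [DecidableEq V] (q : ℝ)
    (g : V → Option Bool → ℝ) :
    ∑ τ : V → Option Bool, restrictionWeight q τ * ∏ v, g v (τ v) =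
      ∏ v, ∑ o, bitWeight q o * g v o := by
  rw [Finset.prod_univ_sum, Fintype.piFinset_univ]
  simp only [restrictionWeight, Finset.prod_mul_distrib]

theorem sum_option_bool (f : Option Bool → ℝ) :
    ∑ o, f o = f none + (f (some true) + f (some false)) := by
  rw [Fintype.sum_option]; simp

theorem sum_restrictionWeight {V : Type} [Fintype V] [DecidableEq V] (q : ℝ) :
    ∑ τ : V → Option Bool, restrictionWeight q τ = 1 := by
  have h := sum_restrictionWeight_mul_prod (V := V) q fun _ _ => 1
  simp only [Finset.prod_const_one, mul_one] at h
  rw [h]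
  refine Finset.prod_eq_one fun v _ => ?_
  rw [sum_option_bool]; simp only [bitWeight]; ring

open Classical in
/-- The indicator of the event that `τ` satisfies the term `T`. -/
noncomputable def termInd {V : Type} (T : Term V) (τ : V → Option Bool) : ℝ :=
  if ∀ l ∈ T, τ l.1 = some l.2 then 1 else 0

theorem sum_restrictionWeight_mul_termInd {V : Type} [Fintype V] [DecidableEq V] (q : ℝ)
    {T : Term V} (hT : TermConsistent T) :
    ∑ τ : V → Option Bool, restrictionWeight q τ * termInd T τ = (q / 2) ^ T.card := by
  classical
  set g : V → Option Bool → ℝ := fun v o => if ∀ l ∈ T, l.1 = v → o = some l.2 then 1 else 0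
    with hg
  have hind : ∀ τ : V → Option Bool, termInd T τ = ∏ v, g v (τ v) := by
    intro τ
    by_cases h : ∀ l ∈ T, τ l.1 = some l.2
    · rw [termInd, if_pos h, Finset.prod_eq_one fun v _ => if_pos fun l hl e => e ▸ h l hl]
    · rw [termInd, if_neg h]
      push Not at h
      obtain ⟨l, hl, hne⟩ := h
      exact (Finset.prod_eq_zero (Finset.mem_univ l.1)
        (if_neg fun h => hne (h l hl rfl))).symm
  simp only [hind]
  rw [sum_restrictionWeight_mul_prod q g]
  have hfac : ∀ v, ∑ o, bitWeight q o * g v o =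
      if v ∈ T.image Prod.fst then q / 2 else 1 := by
    intro v
    split_ifs with hv
    · obtain ⟨l, hl, rfl⟩ := Finset.mem_image.1 hv
      have hgl : ∀ o, g l.1 o = if o = some l.2 then 1 else 0 := fun o =>
        if_congr ⟨fun h => h l hl rfl, fun h m hm e => by rw [hT hm hl e]; exact h⟩ rfl rfl
      simp [hgl, bitWeight]
    · have hgv : ∀ o, g v o = 1 := fun o =>
        if_pos fun m hm e => absurd (Finset.mem_image.2 ⟨m, hm, e⟩) hv
      simp only [hgv, mul_one]
      rw [sum_option_bool]; simp only [bitWeight]; ring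
  simp only [hfac]
  rw [Finset.prod_ite_mem, Finset.univ_inter, Finset.prod_const, Finset.card_image_of_injOn hT]

/-- Disjoint terms are satisfied independently. Expanding the product over subsets `R` of `S`
reduces this to the probability that all terms of `R` hold, and their union is again one consistent
term, of size the sum of their sizes. -/
theorem sum_restrictionWeight_mul_prod_termInd {V : Type} [Fintype V] [DecidableEq V] (q : ℝ)
    {S : DNF V} (hS : (S : Set (Term V)).Pairwise TermDisjoint) (hc : ∀ T ∈ S, TermConsistent T) :
    ∑ τ : V → Option Bool, restrictionWeight q τ * ∏ T ∈ S, (1 - termInd T τ) =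
      ∏ T ∈ S, (1 - (q / 2) ^ T.card) := by
  have hunion : ∀ R ∈ S.powerset, ∀ τ : V → Option Bool,
      ∏ T ∈ R, termInd T τ = termInd (R.biUnion id) τ := by
    intro R _ τ
    by_cases h : ∀ T ∈ R, ∀ l ∈ T, τ l.1 = some l.2
    · rw [Finset.prod_eq_one fun T hT => show termInd T τ = 1 from if_pos (h T hT), termInd, if_pos]
      intro l hl
      obtain ⟨T, hT, hl⟩ := Finset.mem_biUnion.1 hl
      exact h T hT l hl
    · push Not at h
      obtain ⟨T, hT, l, hl, hne⟩ := h
      rw [Finset.prod_eq_zero hT (show termInd T τ = 0 from if_neg fun h => hne (h l hl)), termInd, if_neg]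
      exact fun h => hne (h l (Finset.mem_biUnion.2 ⟨T, hT, hl⟩))
  have hcons : ∀ R ∈ S.powerset, TermConsistent (R.biUnion id) := by
    intro R hR l hl m hm e
    simp only [Finset.coe_biUnion, Set.mem_iUnion, Finset.mem_coe, id] at hl hm
    obtain ⟨T, hT, hl⟩ := hl
    obtain ⟨U, hU, hm⟩ := hm
    have hRS := Finset.mem_powerset.1 hR
    by_cases hTU : T = U
    · subst hTU; exact hc T (hRS hT) hl hm e
    · exact absurd e (hS (hRS hT) (hRS hU) hTU l hl m hm)
  have hcard : ∀ R ∈ S.powerset, (R.biUnion id).card = ∑ T ∈ R, T.card := by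
    intro R hR
    have hRS := Finset.mem_powerset.1 hR
    refine Finset.card_biUnion fun T hT U hU hTU => ?_
    exact Finset.disjoint_left.2 fun l hl hl' => hS (hRS hT) (hRS hU) hTU l hl l hl' rfl
  simp only [sub_eq_add_neg, Finset.prod_one_add, Finset.mul_sum]
  rw [Finset.sum_comm]
  refine Finset.sum_congr rfl fun R hR => ?_
  simp only [Finset.prod_neg, hunion R hR, ← mul_assoc, mul_comm _ ((-1 : ℝ) ^ R.card)]
  simp only [mul_assoc, ← Finset.mul_sum]
  rw [sum_restrictionWeight_mul_termInd q (hcons R hR), hcard R hR, Finset.prod_pow_eq_pow_sum]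

/-- The exponential moment of the number of bits set in a block, used for a Markov bound: each bit
contributes the factor `(1 - q) + 2 * q`. -/
theorem sum_restrictionWeight_mul_blockCount {k ℓ : ℕ} (q : ℝ) (b : Fin k) :
    ∑ τ : BinVar k ℓ → Option Bool, restrictionWeight q τ * 2 ^ blockCount τ b =
      (1 + q) ^ ℓ := by
  have hind : ∀ τ : BinVar k ℓ → Option Bool, (2 : ℝ) ^ blockCount τ b =
      ∏ v : BinVar k ℓ, if v.1 = b ∧ τ v ≠ none then 2 else 1 := by
    intro τ
    rw [Fintype.prod_prod_type, Finset.prod_eq_single b]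
    · simp [blockCount, Finset.prod_ite]
    · intro c _ hc
      simp [hc]
    · simp
  simp only [hind]
  rw [sum_restrictionWeight_mul_prod q
    fun (v : BinVar k ℓ) o => if v.1 = b ∧ o ≠ none then 2 else 1,
    Fintype.prod_prod_type, Finset.prod_eq_single b]
  · rw [Finset.prod_congr rfl (g := fun _ => 1 + q)]
    · simp
    · intro v _
      rw [sum_option_bool]; simp [bitWeight]
  · intro c _ hc
    refine Finset.prod_eq_one fun v _ => ?_
    rw [sum_option_bool]; simp [hc, bitWeight]
  · simp

/-- A random restriction satisfies every DNF of a small family of DNFs with many disjoint terms,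
and assigns few variables in each block. -/
theorem exists_restriction_satisfying {k ℓ s m : ℕ} {q B : ℝ} (h₀ : 0 ≤ q) (h₁ : q ≤ 1)
    (hB : 0 < B) (𝒮 : Finset (DNF (BinVar k ℓ)))
    (hdisj : ∀ S ∈ 𝒮, (S : Set (Term (BinVar k ℓ))).Pairwise TermDisjoint)
    (hcons : ∀ S ∈ 𝒮, ∀ T ∈ S, TermConsistent T) (hcard : ∀ S ∈ 𝒮, ∀ T ∈ S, T.card ≤ s)
    (hm : ∀ S ∈ 𝒮, m ≤ S.card)
    (hsum : 𝒮.card * (1 - (q / 2) ^ s) ^ m + k * ((1 + q) ^ ℓ / B) < 1) :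
    ∃ τ : BinVar k ℓ → Option Bool, (∀ b, (2 : ℝ) ^ blockCount τ b < B) ∧
      ∀ S ∈ 𝒮, ∃ T ∈ S, ∀ l ∈ T, τ l.1 = some l.2 := by
  classical
  have hI : ∀ (T : Term (BinVar k ℓ)) τ, 0 ≤ 1 - termInd T τ := by
    intro T τ; rw [termInd]; split_ifs <;> norm_num
  have hq2 : 0 ≤ q / 2 := by linarith
  have hq2' : q / 2 ≤ 1 := by linarith
  -- A union bound as a first moment: `f` is at least 1 as soon as one DNF of `𝒮` has no satisfied
  -- term or one block has too many bits, while its expectation is below 1.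
  set f : (BinVar k ℓ → Option Bool) → ℝ := fun τ =>
    ∑ S ∈ 𝒮, ∏ T ∈ S, (1 - termInd T τ) + ∑ b, 2 ^ blockCount τ b / B with hf
  have hE : ∑ τ, restrictionWeight q τ * f τ < ∑ τ : BinVar k ℓ → Option Bool,
      restrictionWeight q τ * 1 := by
    simp only [mul_one]
    rw [sum_restrictionWeight]
    refine lt_of_le_of_lt ?_ hsum
    simp only [hf, mul_add, Finset.sum_add_distrib, Finset.mul_sum]
    refine add_le_add ?_ ?_
    · rw [Finset.sum_comm, ← nsmul_eq_mul]
      refine Finset.sum_le_card_nsmul _ _ _ fun S hS => ?_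
      rw [sum_restrictionWeight_mul_prod_termInd q (hdisj S hS) (hcons S hS)]
      have hs1 : (q / 2) ^ s ≤ 1 := pow_le_one₀ hq2 hq2'
      calc ∏ T ∈ S, (1 - (q / 2) ^ T.card) ≤ ∏ T ∈ S, (1 - (q / 2) ^ s) := by
            refine Finset.prod_le_prod (fun T hT => ?_) fun T hT => ?_
            · have := pow_le_one₀ (n := T.card) hq2 hq2'; linarith
            · have := pow_le_pow_of_le_one hq2 hq2' (hcard S hS T hT); linarith
        _ = (1 - (q / 2) ^ s) ^ S.card := by simp
        _ ≤ _ := pow_le_pow_of_le_one (by linarith)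
            (by have : 0 ≤ (q / 2) ^ s := pow_nonneg hq2 s; linarith) (hm S hS)
    · rw [Finset.sum_comm]
      simp only [← mul_div_assoc, ← Finset.sum_div]
      simp [sum_restrictionWeight_mul_blockCount]
  obtain ⟨τ, -, hτ⟩ := Finset.exists_lt_of_sum_lt hE
  have hfτ : f τ < 1 := lt_of_mul_lt_mul_left hτ (restrictionWeight_nonneg h₀ h₁ τ)
  have hA : ∀ S ∈ 𝒮, 0 ≤ ∏ T ∈ S, (1 - termInd T τ) := fun S _ =>
    Finset.prod_nonneg fun T _ => hI T τ
  have hC : ∀ b ∈ (Finset.univ : Finset (Fin k)), 0 ≤ (2 : ℝ) ^ blockCount τ b / B :=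
    fun b _ => by positivity
  refine ⟨τ, fun b => ?_, fun S hS => ?_⟩
  · have h1 := Finset.single_le_sum hC (Finset.mem_univ b)
    have h2 := Finset.sum_nonneg hA
    have : (2 : ℝ) ^ blockCount τ b / B < 1 := by simp only [hf] at hfτ; linarith
    rwa [div_lt_one hB] at this
  · by_contra! hno
    have h1 := Finset.single_le_sum hA hS
    have h2 := Finset.sum_nonneg hC
    have h3 : ∏ T ∈ S, (1 - termInd T τ) = 1 := by
      refine Finset.prod_eq_one fun T hT => ?_
      obtain ⟨l, hl, hne⟩ := hno T hT
      rw [termInd, if_neg fun h => hne (h l hl), sub_zero]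
    simp only [hf] at hfτ
    linarith

/-! ### The switching lemma -/

theorem TermConsistent.subset {V : Type} {S T : Term V} (hT : TermConsistent T) (h : S ⊆ T) :
    TermConsistent S := Set.InjOn.mono (Finset.coe_subset.2 h) hT

theorem consistent_of_mem_restrictDNF {V : Type} {D : DNF V} {α : V → Option Bool} {T : Term V}
    (h : T ∈ restrictDNF D α) : TermConsistent T ∧ ∀ l ∈ T, α l.1 = none := by
  obtain ⟨S, -, hS, -, rfl⟩ := mem_restrictDNF.1 h
  exact ⟨hS.subset (Finset.filter_subset _ _), fun l hl => (Finset.mem_filter.1 hl).2⟩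

theorem pe_pos (s : ℕ) : 0 < pe s := by unfold pe; positivity

/-- Union bound over `N` DNFs, each with `p * L` disjoint terms of success probability at least `1 /
p`: each fails with probability at most `e⁻ᴸ ≤ (3/8)ᴸ`. The remaining `1 / 4` is left for `FewBits`.
-/
theorem pow_mul_one_sub_inv_pow_le {L p : ℕ} (hL : 1 ≤ L) (hp : 0 < p) {N : ℕ} (hN : N ≤ 2 ^ L) :
    (N : ℝ) * (1 - 1 / (p : ℝ)) ^ (p * L) ≤ 3 / 4 := by
  have hp' : (1 : ℝ) ≤ p := by exact_mod_cast hp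
  have h1 : (1 - 1 / (p : ℝ)) ^ p ≤ Real.exp (-1) := Real.one_sub_div_pow_le_exp_neg hp'
  have h0 : (0 : ℝ) ≤ 1 - 1 / p := by
    rw [sub_nonneg, div_le_one (by linarith)]; exact hp'
  have h2 : Real.exp (-1) ≤ 3 / 8 := by have := Real.exp_neg_one_lt_d9; linarith
  calc (N : ℝ) * (1 - 1 / (p : ℝ)) ^ (p * L) ≤ 2 ^ L * (3 / 8) ^ L := by
        rw [pow_mul]
        gcongr
        · exact_mod_cast hN
        · exact h1.trans h2
    _ = (3 / 4) ^ L := by rw [← mul_pow]; norm_num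
    _ ≤ 3 / 4 := pow_le_of_le_one (by norm_num) (by norm_num) (by omega)

theorem inv_pe_eq (s : ℕ) : ((1 / 2 ^ (s + 2) : ℝ) / 2) ^ s = 1 / (pe s : ℝ) := by
  rw [div_div, ← pow_succ, div_pow, one_pow, ← pow_mul, pe]
  push_cast
  congr 2
  ring

/-- The probability that a random restriction assigns too many variables in some block is small. -/
def FewBits (k ℓ s : ℕ) : Prop :=
  (k : ℝ) * ((1 + 1 / 2 ^ (s + 2)) ^ ℓ / (2 : ℝ) ^ ((ℓ : ℝ) / 2 ^ (s + 1))) < 1 / 4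

theorem blockCount_or_le {k ℓ : ℕ} (σ τ : BinVar k ℓ → Option Bool) (b : Fin k) :
    blockCount (fun v => (σ v).or (τ v)) b ≤ blockCount σ b + blockCount τ b := by
  unfold blockCount
  refine (Finset.card_le_card ?_).trans (Finset.card_union_le _ _)
  intro j hj
  simp only [Finset.mem_filter, Finset.mem_univ, true_and, Finset.mem_union] at hj ⊢
  by_contra! h
  simp [h.1, h.2] at hj

theorem extends_or {V : Type} (σ τ : V → Option Bool) : Extends σ fun v => (σ v).or (τ v) :=
  fun v b h => by simp [h]

/-- After all of `W` has been queried, the answers coincide on `W` with `setOn W A` for some `A`,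
and the tree for that restriction of `D` can be continued. -/
theorem decDepth_of_cover {V : Type} [DecidableEq V] {n : ℕ} {D : DNF V} {σ : V → Option Bool}
    (W : Finset V) (h : ∀ A ⊆ W, DecDepth n σ (DNFTrue (restrictDNF D (setOn W A)))) :
    DecDepth (n + W.card) σ (DNFTrue D) := by
  refine DecDepth.query W fun τ hτ hW => ?_
  have hA := h (W.filter fun v => τ v = some true) (Finset.filter_subset _ _)
  refine (hA.mono hτ).congr fun x hx => dnfTrue_restrictDNF fun v b hv => ?_
  by_cases hvW : v ∈ W
  · obtain ⟨c, hc⟩ := Option.ne_none_iff_exists'.1 (hW v hvW)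
    simp only [setOn, hvW, if_true, Finset.mem_filter, true_and, hc, Option.some.injEq,
      Bool.decide_eq_true] at hv
    exact hv ▸ hx v c hc
  · simp [setOn, hvW] at hv

/-- Induction on the width `j`. One round replaces each remaining DNF by its restrictions to all
assignments of its cover, so the family grows from `2 ^ L` to `2 ^ (L * (1 + s * pe s))`. The depth
bound solves the recurrence in which a round costs the cover size `L * s * pe s` and passes on to
`j` with `L * (1 + s * pe s)`. -/
theorem exists_restriction_decDepth {k ℓ s : ℕ} (hN : FewBits k ℓ s) {j : ℕ} (hj : j ≤ s) {L : ℕ}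
    (hL : 1 ≤ L) (σ₀ : BinVar k ℓ → Option Bool) (𝒟 : Finset (DNF (BinVar k ℓ)))
    (hcard : 𝒟.card ≤ 2 ^ L) (hw : ∀ D ∈ 𝒟, ∀ T ∈ D, T.card ≤ j) :
    ∃ σ, Extends σ₀ σ ∧
      (∀ b, (blockCount σ b : ℝ) ≤ blockCount σ₀ b + j * ((ℓ : ℝ) / 2 ^ (s + 1))) ∧
      ∀ D ∈ 𝒟, DecDepth (L * (1 + s * pe s) ^ j - L) σ (DNFTrue D) := by
  classical
  induction j generalizing L σ₀ 𝒟 with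
  | zero =>
    refine ⟨σ₀, Extends.refl _, by simp, fun D hD => ConstOn.decDepth ?_ _⟩
    rcases D.eq_empty_or_nonempty with rfl | ⟨T, hT⟩
    · exact Or.inr fun x _ => not_dnfTrue_empty x
    · have hT0 : T = ∅ := Finset.card_eq_zero.1 (Nat.le_zero.1 (hw D hD T hT))
      exact Or.inl fun x _ => ⟨T, hT, by simp [hT0, TermTrue]⟩
  | succ j ih =>
    set m := pe s * L with hmdef
    have hdich : ∀ D : DNF (BinVar k ℓ), ∃ (S : DNF (BinVar k ℓ)) (W : Finset (BinVar k ℓ)),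
        D ∈ 𝒟 → (S ⊆ restrictDNF D σ₀ ∧ (S : Set (Term (BinVar k ℓ))).Pairwise TermDisjoint ∧
          m ≤ S.card) ∨ (W.card ≤ m * (j + 1) ∧ ∀ A,
            ∀ T ∈ restrictDNF (restrictDNF D σ₀) (setOn W A), T.card ≤ j) := by
      intro D
      by_cases hD : D ∈ 𝒟
      · have hE := card_restrictDNF (hw D hD) σ₀
        rcases disjoint_terms_or_cover hE m with ⟨S, hS⟩ | ⟨W, hW, hW'⟩
        · exact ⟨S, ∅, fun _ => Or.inl hS⟩
        · exact ⟨∅, W, fun _ => Or.inr ⟨hW, fun A => card_restrictDNF_setOn hE hW' A⟩⟩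
      · exact ⟨∅, ∅, fun h => absurd h hD⟩
    choose S W hSW using hdich
    set good : DNF (BinVar k ℓ) → Prop := fun D => S D ⊆ restrictDNF D σ₀ ∧
      (S D : Set (Term (BinVar k ℓ))).Pairwise TermDisjoint ∧ m ≤ (S D).card with hgood
    have hbad : ∀ D ∈ 𝒟, ¬ good D → (W D).card ≤ m * (j + 1) ∧ ∀ A,
        ∀ T ∈ restrictDNF (restrictDNF D σ₀) (setOn (W D) A), T.card ≤ j :=
      fun D hD hg => (hSW D hD).resolve_left hg
    -- With `q = 1 / 2 ^ (s + 2)` a term of `s` literals holds with probability `(q / 2) ^ s = 1 /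
    -- pe s`, and the expected number of bits set in a block is half of the allowed `ℓ / 2 ^ (s +
    -- 1)`.
    obtain ⟨τ, hτB, hτS⟩ := exists_restriction_satisfying (k := k) (ℓ := ℓ) (s := s) (m := m)
      (q := 1 / 2 ^ (s + 2)) (B := (2 : ℝ) ^ ((ℓ : ℝ) / 2 ^ (s + 1))) (by positivity)
      ((div_le_one (by positivity)).2 (one_le_pow₀ (by norm_num))) (by positivity)
      ((𝒟.filter good).image S)
      (by
        simp only [Finset.forall_mem_image, Finset.mem_filter]
        exact fun D hD => hD.2.2.1)
      (by
        simp only [Finset.forall_mem_image, Finset.mem_filter]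
        exact fun D hD T hT => (consistent_of_mem_restrictDNF (hD.2.1 hT)).1)
      (by
        simp only [Finset.forall_mem_image, Finset.mem_filter]
        exact fun D hD T hT => (card_restrictDNF (hw D hD.1) σ₀ T (hD.2.1 hT)).trans hj)
      (by
        simp only [Finset.forall_mem_image, Finset.mem_filter]
        exact fun D hD => hD.2.2.2)
      (by
        rw [inv_pe_eq]
        have h1 : ((𝒟.filter good).image S).card ≤ 2 ^ L :=
          (Finset.card_image_le.trans (Finset.card_filter_le _ _)).trans hcard
        have h2 := pow_mul_one_sub_inv_pow_le hL (pe_pos s) h1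
        have h3 := hN
        unfold FewBits at h3
        linarith)
    -- `σ₀` takes precedence over `τ`; this is harmless because the terms of `restrictDNF D σ₀` only
    -- mention variables free in `σ₀`.
    set σ₁ : BinVar k ℓ → Option Bool := fun v => (σ₀ v).or (τ v) with hσ₁
    set 𝒟' := (𝒟.filter fun D => ¬ good D).biUnion fun D => (W D).powerset.image fun A =>
      restrictDNF (restrictDNF D σ₀) (setOn (W D) A) with h𝒟'
    have hcard' : 𝒟'.card ≤ 2 ^ (L * (1 + s * pe s)) := by
      refine (Finset.card_biUnion_le_card_mul _ _ (2 ^ (m * s)) fun D hD => ?_).trans ?_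
      · refine Finset.card_image_le.trans ?_
        rw [Finset.card_powerset]
        refine Nat.pow_le_pow_right (by norm_num) ?_
        rw [Finset.mem_filter] at hD
        exact ((hbad D hD.1 hD.2).1).trans (Nat.mul_le_mul_left _ hj)
      · calc _ ≤ 2 ^ L * 2 ^ (m * s) :=
              Nat.mul_le_mul_right _ ((Finset.card_filter_le _ _).trans hcard)
          _ = _ := by rw [← pow_add, hmdef]; congr 1; ring
    obtain ⟨σ, hσ, hσb, hσD⟩ := ih (by omega) (L := L * (1 + s * pe s))
      (Nat.one_le_iff_ne_zero.2 (by positivity)) σ₁ 𝒟' hcard' (by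
        intro E hE
        simp only [h𝒟', Finset.mem_biUnion, Finset.mem_filter, Finset.mem_image] at hE
        obtain ⟨D, hD, A, -, rfl⟩ := hE
        exact (hbad D hD.1 hD.2).2 A)
    have hσ₀ : Extends σ₀ σ := (extends_or σ₀ τ).trans hσ
    refine ⟨σ, hσ₀, fun b => ?_, fun D hD => ?_⟩
    · have h1 : (blockCount σ₁ b : ℝ) ≤ blockCount σ₀ b + blockCount τ b := by
        exact_mod_cast blockCount_or_le σ₀ τ b
      have h2 : (blockCount τ b : ℝ) < (ℓ : ℝ) / 2 ^ (s + 1) := by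
        have := hτB b
        rw [← Real.rpow_natCast] at this
        exact (Real.rpow_lt_rpow_left_iff (by norm_num)).1 this
      have h3 := hσb b
      push_cast
      linarith
    · have hDσ : ∀ x, Agrees x σ → (DNFTrue (restrictDNF D σ₀) x ↔ DNFTrue D x) :=
        fun x hx => dnfTrue_restrictDNF (hx.of_extends hσ₀)
      by_cases hg : good D
      · refine ConstOn.decDepth (Or.inl fun x hx => ?_) _
        obtain ⟨T, hT, hTτ⟩ := hτS (S D)
          (Finset.mem_image_of_mem _ (Finset.mem_filter.2 ⟨hD, hg⟩))
        refine (hDσ x hx).1 ⟨T, hg.1 hT, fun l hl => hx _ _ (hσ _ _ ?_)⟩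
        simp [hσ₁, (consistent_of_mem_restrictDNF (hg.1 hT)).2 l hl, hTτ l hl]
      · have hW := (hbad D hD hg).1.trans (Nat.mul_le_mul_left m hj)
        have hdec := (decDepth_of_cover (σ := σ) (W D) fun A hA => hσD _ (by
          simp only [h𝒟', Finset.mem_biUnion, Finset.mem_filter, Finset.mem_image]
          exact ⟨D, ⟨hD, hg⟩, A, Finset.mem_powerset.2 hA, rfl⟩)).congr hDσ
        refine hdec.mono_depth ?_
        have h1 : L * (1 + s * pe s) ≤ L * (1 + s * pe s) * (1 + s * pe s) ^ j :=
          Nat.le_mul_of_pos_right _ (by positivity)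
        have h2 : L * (1 + s * pe s) * (1 + s * pe s) ^ j = L * (1 + s * pe s) ^ (j + 1) := by ring
        have h3 : L * (1 + s * pe s) = L + m * s := by rw [hmdef]; ring
        omega

/-! ### The adversary -/

/-- The colour of the vertex that `x` chooses in block `b`: its number of ones modulo `k - 1`. -/
def blockColor {k ℓ : ℕ} (x : BinVar k ℓ → Bool) (b : Fin k) : ℕ :=
  (Finset.univ.filter fun j : Fin ℓ => x (b, j) = true).card % (k - 1)

/-- The blocks in which more than three quarters of the bits are assigned. -/
def heavyBlocks {k ℓ : ℕ} (α : BinVar k ℓ → Option Bool) : Finset (Fin k) :=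
  Finset.univ.filter fun b => 3 * ℓ < 4 * blockCount α b

/-- Some total assignment extending `α` has distinct colours on `A` and on the heavy blocks. -/
def Colorable {k ℓ : ℕ} (α : BinVar k ℓ → Option Bool) (A : Finset (Fin k)) : Prop :=
  ∃ x, Agrees x α ∧ Set.InjOn (blockColor x) (↑(A ∪ heavyBlocks α) : Set (Fin k))

/-- The number of variables that `α` assigns and `σ` does not. -/
def extraCount {k ℓ : ℕ} (σ α : BinVar k ℓ → Option Bool) : ℕ :=
  (Finset.univ.filter fun v => α v ≠ none ∧ σ v = none).card

theorem blockCount_mono {k ℓ : ℕ} {α β : BinVar k ℓ → Option Bool} (h : Extends α β)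
    (b : Fin k) : blockCount α b ≤ blockCount β b :=
  Finset.card_le_card (Finset.monotone_filter_right _ fun _ _ hj => h.ne_none hj)

theorem heavyBlocks_mono {k ℓ : ℕ} {α β : BinVar k ℓ → Option Bool} (h : Extends α β) :
    heavyBlocks α ⊆ heavyBlocks β :=
  Finset.monotone_filter_right _ fun b _ hb =>
    lt_of_lt_of_le hb (Nat.mul_le_mul_left 4 (blockCount_mono h b))

theorem Colorable.mono {k ℓ : ℕ} {α β : BinVar k ℓ → Option Bool} {A B : Finset (Fin k)}
    (h : Colorable β B) (hα : Extends α β) (hA : A ⊆ B) : Colorable α A := by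
  obtain ⟨x, hx, hinj⟩ := h
  exact ⟨x, hx.of_extends hα,
    hinj.mono (Finset.coe_subset.2 (Finset.union_subset_union hA (heavyBlocks_mono hα)))⟩

/-- A block that is not heavy has at least `r` free bits. Setting `0, …, r` of them to true gives `r
+ 1` weights that are distinct modulo `k - 1`, and at most `r` colours are taken, so one choice is
new. Blocks that are heavy already have a colour of their own. -/
theorem Colorable.insert {k ℓ r : ℕ} {α : BinVar k ℓ → Option Bool} {A : Finset (Fin k)}
    (h : Colorable α A) (hcard : (A ∪ heavyBlocks α).card ≤ r) (hrk : r < k - 1)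
    (hrℓ : 4 * r ≤ ℓ) (b : Fin k) : Colorable α (insert b A) := by
  obtain ⟨x, hx, hinj⟩ := h
  by_cases hb : b ∈ A ∪ heavyBlocks α
  · refine ⟨x, hx, ?_⟩
    rwa [Finset.insert_union, Finset.insert_eq_of_mem hb]
  set H := A ∪ heavyBlocks α with hH
  have hlight : 4 * blockCount α b ≤ 3 * ℓ := by
    by_contra! hlt
    exact hb (Finset.mem_union_right _ (Finset.mem_filter.2 ⟨Finset.mem_univ b, hlt⟩))
  set F := Finset.univ.filter fun j : Fin ℓ => α (b, j) = none with hF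
  have hFcard : r ≤ F.card := by
    have h1 : F.card + (Finset.univ.filter fun j : Fin ℓ => ¬ α (b, j) = none).card =
        (Finset.univ : Finset (Fin ℓ)).card := Finset.card_filter_add_card_filter_not _
    rw [Finset.card_univ, Fintype.card_fin] at h1
    have h2 : blockCount α b =
      (Finset.univ.filter fun j : Fin ℓ => ¬ α (b, j) = none).card := rfl
    omega
  set T := Finset.univ.filter fun j : Fin ℓ => α (b, j) = some true with hT
  have hpig : (H.image (blockColor x)).card <
      ((Finset.range (r + 1)).image fun t => (T.card + t) % (k - 1)).card := by
    rw [Finset.card_image_of_injOn (s := Finset.range (r + 1)), Finset.card_range]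
    · exact Nat.lt_succ_of_le (Finset.card_image_le.trans hcard)
    · intro t ht u hu htu
      simp only [Finset.coe_range, Set.mem_Iio] at ht hu
      have : t ≡ u [MOD k - 1] := Nat.ModEq.add_left_cancel' T.card htu
      exact Nat.ModEq.eq_of_lt_of_lt this (by omega) (by omega)
  obtain ⟨c, hc, hcH⟩ := Finset.exists_mem_notMem_of_card_lt_card hpig
  obtain ⟨t, ht, rfl⟩ := Finset.mem_image.1 hc
  rw [Finset.mem_range] at ht
  obtain ⟨S, hSF, hSt⟩ := Finset.exists_subset_card_eq (show t ≤ F.card by omega)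
  set y : BinVar k ℓ → Bool := fun v =>
    if v.1 = b then (α v).getD (decide (v.2 ∈ S)) else x v with hy
  have hyb : blockColor y b = (T.card + t) % (k - 1) := by
    have hdis : Disjoint T S := Finset.disjoint_left.2 fun j hj hjS => by
      have h1 := (Finset.mem_filter.1 hj).2
      have h2 := (Finset.mem_filter.1 (hSF hjS)).2
      rw [h1] at h2; simp at h2
    have hset : (Finset.univ.filter fun j : Fin ℓ => y (b, j) = true) = T ∪ S := by
      ext j
      simp only [Finset.mem_filter, Finset.mem_univ, true_and, Finset.mem_union, hy, hT, if_true]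
      rcases hj : α (b, j) with _ | c
      · simp
      · have : j ∉ S := fun hjS => by
          have h2 := (Finset.mem_filter.1 (hSF hjS)).2
          rw [hj] at h2; simp at h2
        simp [this]
    rw [blockColor, hset, Finset.card_union_of_disjoint hdis, hSt]
  have hyne : ∀ c, c ≠ b → blockColor y c = blockColor x c := by
    intro c hc
    simp only [blockColor, hy, if_neg hc]
  refine ⟨y, fun v c hv => ?_, ?_⟩
  · by_cases hvb : v.1 = b
    · simp [hy, hvb, hv]
    · simp [hy, hvb, hx v c hv]
  · rw [Finset.insert_union, ← hH, Finset.coe_insert, Set.injOn_insert hb]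
    have heq : Set.EqOn (blockColor y) (blockColor x) (H : Set (Fin k)) :=
      fun c hcH => hyne c fun e => hb (e ▸ hcH)
    refine ⟨hinj.congr heq.symm, ?_⟩
    rw [heq.image_eq, hyb]
    rwa [← Finset.coe_image, Finset.mem_coe]

theorem extraCount_self {k ℓ : ℕ} (σ : BinVar k ℓ → Option Bool) : extraCount σ σ = 0 := by
  rw [extraCount, Finset.card_eq_zero, Finset.filter_eq_empty_iff]
  exact fun v _ h => h.1 h.2

theorem extraCount_update_le {k ℓ : ℕ} (σ α : BinVar k ℓ → Option Bool) (v : BinVar k ℓ)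
    (o : Option Bool) : extraCount σ (Function.update α v o) ≤ extraCount σ α + 1 := by
  refine (Finset.card_le_card (t := insert v (Finset.univ.filter fun v => α v ≠ none ∧ σ v = none))
    fun w hw => ?_).trans (Finset.card_insert_le _ _)
  by_cases hwv : w = v
  · simp [hwv]
  · refine Finset.mem_insert_of_mem ?_
    simpa [Function.update_of_ne hwv] using hw

theorem heavyBlocks_update_subset {k ℓ : ℕ} (α : BinVar k ℓ → Option Bool) (v : BinVar k ℓ)
    (o : Option Bool) : heavyBlocks (Function.update α v o) ⊆ insert v.1 (heavyBlocks α) := by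
  intro b hb
  by_cases hbv : b = v.1
  · simp [hbv]
  · refine Finset.mem_insert_of_mem (Finset.mem_filter.2 ⟨Finset.mem_univ b, ?_⟩)
    have hcount : blockCount (Function.update α v o) b = blockCount α b := by
      unfold blockCount
      congr 1
      refine Finset.filter_congr fun j _ => ?_
      rw [Function.update_of_ne]
      rintro rfl
      exact hbv rfl
    rw [← hcount]
    exact (Finset.mem_filter.1 hb).2

/-- Since `σ` sets at most half of a block, each heavy block has used up at least a quarter of its
bits beyond `σ`. -/
theorem card_heavyBlocks_mul_le {k ℓ : ℕ} {σ : BinVar k ℓ → Option Bool}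
    (hσ : ∀ b, 2 * blockCount σ b ≤ ℓ) (α : BinVar k ℓ → Option Bool) :
    (heavyBlocks α).card * ℓ ≤ 4 * extraCount σ α := by
  have hfib : extraCount σ α =
      ∑ b, (Finset.univ.filter fun j : Fin ℓ => α (b, j) ≠ none ∧ σ (b, j) = none).card := by
    simp only [extraCount, Finset.card_filter]
    rw [Fintype.sum_prod_type]
  have hblock : ∀ b, blockCount α b ≤ blockCount σ b +
      (Finset.univ.filter fun j : Fin ℓ => α (b, j) ≠ none ∧ σ (b, j) = none).card := by
    intro b
    unfold blockCount
    refine (Finset.card_le_card ?_).trans (Finset.card_union_le _ _)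
    intro j hj
    simp only [Finset.mem_filter, Finset.mem_univ, true_and, Finset.mem_union] at hj ⊢
    tauto
  rw [hfib, Finset.mul_sum, ← smul_eq_mul, ← Finset.sum_const]
  refine (Finset.sum_le_sum fun b hb => ?_).trans
    (Finset.sum_le_sum_of_subset (Finset.subset_univ _))
  have h1 := (Finset.mem_filter.1 hb).2
  have h2 := hblock b
  have h3 := hσ b
  omega

/-- The adversary answers the queries of a decision tree. -/
theorem DecDepth.exists_branch {k ℓ r E : ℕ} {σ : BinVar k ℓ → Option Bool}
    (hσ : ∀ b, 2 * blockCount σ b ≤ ℓ) (hℓ : 0 < ℓ) (hrk : r < k - 1) (hrℓ : 4 * r ≤ ℓ)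
    (hE : 4 * E + 4 * ℓ ≤ r * ℓ) {n : ℕ} {τ α : BinVar k ℓ → Option Bool}
    {P : (BinVar k ℓ → Bool) → Prop} (h : DecDepth n τ P) (hτα : Extends τ α)
    {A : Finset (Fin k)} (hα : Colorable α A) (hA : A.card ≤ 4) (hαE : extraCount σ α + n ≤ E) :
    ∃ α' τ', Extends α α' ∧ Colorable α' A ∧ extraCount σ α' ≤ extraCount σ α + n ∧
      Extends τ τ' ∧ Extends τ' α' ∧ extraCount σ τ' ≤ extraCount σ τ + n ∧ ConstOn τ' P := by
  induction n generalizing τ α with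
  | zero => exact ⟨α, τ, Extends.refl _, hα, le_rfl, Extends.refl _, hτα, le_rfl, h⟩
  | succ n ih =>
    rcases h with h | ⟨v, hv, h⟩
    · exact ⟨α, τ, Extends.refl _, hα, by omega, Extends.refl _, hτα, by omega, h⟩
    -- The tree path `τ` and the adversary's assignment `α` are tracked separately: `α` also carries
    -- bits from elsewhere, whereas only the bits on the path count for `τ'`.
    suffices ∃ (c : Bool) (α₁ : BinVar k ℓ → Option Bool), Extends α α₁ ∧ α₁ v = some c ∧
        Colorable α₁ A ∧ extraCount σ α₁ ≤ extraCount σ α + 1 by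
      obtain ⟨c, α₁, hα₁, hc, hcol, hex⟩ := this
      obtain ⟨α', τ', h1, h2, h3, h4, h5, h6, h7⟩ :=
        ih (h c) (update_extends (hτα.trans hα₁) hc) hcol (by omega)
      have := extraCount_update_le σ τ v (some c)
      exact ⟨α', τ', hα₁.trans h1, h2, by omega, (extends_update hv c).trans h4, h5, by omega, h7⟩
    rcases hαv : α v with _ | c
    · have hheavy := card_heavyBlocks_mul_le hσ α
      have hH : (A ∪ heavyBlocks α).card ≤ r := by
        refine (Finset.card_union_le _ _).trans ?_
        have : ((heavyBlocks α).card + 4) * ℓ ≤ r * ℓ := by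
          rw [add_mul]; omega
        have := Nat.le_of_mul_le_mul_right this hℓ
        omega
      -- Only the queried block can become heavy, so it is given a fresh colour first and the query
      -- is answered according to the resulting `x`.
      obtain ⟨x, hx, hinj⟩ := hα.insert hH hrk hrℓ v.1
      refine ⟨x v, Function.update α v (some (x v)), extends_update hαv _, by simp,
        ⟨x, hx.update v, hinj.mono (Finset.coe_subset.2 ?_)⟩, extraCount_update_le _ _ _ _⟩
      refine Finset.union_subset ?_ ((heavyBlocks_update_subset _ _ _).trans ?_)
      · exact (Finset.subset_insert _ _).trans Finset.subset_union_left
      · rw [Finset.insert_union]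
        exact Finset.insert_subset_insert _ Finset.subset_union_right
    · exact ⟨c, α, Extends.refl _, hαv, hα, by omega⟩

/-- Below a restriction under which all lines have shallow decision trees, no line of a derivation
can be falsified by a small colourable partial assignment. -/
theorem ResDerivation.not_falsified {k ℓ r s h : ℕ} {σ : BinVar k ℓ → Option Bool}
    (hσ : ∀ b, 2 * blockCount σ b ≤ ℓ) (hℓ : 0 < ℓ) (hrk : r < k - 1) (hrℓ : 4 * r ≤ ℓ)
    (hE : 4 * (3 * h) + 4 * ℓ ≤ r * ℓ) {F : Set (Clause (BinVar k ℓ))}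
    (hF : ∀ C ∈ F, ∃ i j : Fin k, ∀ x, Agrees x σ → Set.InjOn (blockColor x) {i, j} →
      DNFTrue C.toDNF x)
    {π : List (DNF (BinVar k ℓ))} (hπ : ResDerivation s F π)
    (hdec : ∀ D ∈ π, DecDepth h σ (DNFTrue D)) :
    ∀ D ∈ π, ∀ τ, Extends σ τ → Colorable τ ∅ → extraCount σ τ ≤ h →
      ¬ ∀ x, Agrees x τ → ¬ DNFTrue D x := by
  have hinsert : ∀ {α : BinVar k ℓ → Option Bool} {A : Finset (Fin k)}, Colorable α A →
      A.card ≤ 4 → extraCount σ α ≤ 3 * h → ∀ b, Colorable α (insert b A) := by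
    intro α A hα hA hex b
    refine hα.insert ((Finset.card_union_le _ _).trans ?_) hrk hrℓ b
    have h1 := card_heavyBlocks_mul_le hσ α
    have : ((heavyBlocks α).card + 4) * ℓ ≤ r * ℓ := by rw [add_mul]; omega
    have := Nat.le_of_mul_le_mul_right this hℓ
    omega
  induction hπ with
  | nil => simp
  | cons π Ps D hπ hPs hD ih =>
    have ih := ih fun E hE => hdec E (List.mem_cons_of_mem _ hE)
    intro E hEπ
    rcases List.mem_cons.1 hEπ with rfl | hEπ
    swap
    · exact ih E hEπ
    intro τ hτ hcol hex hfalse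
    -- The premises are forced true one after the other. An axiom costs two protected blocks, a
    -- derived line costs `h` bits. With at most two premises, this explains the budgets of 4 blocks
    -- and, including the `h` bits of `τ`, of `3 * h` bits.
    have hprem : ∀ Qs : List (DNF (BinVar k ℓ)), (∀ P ∈ Qs, P ∈ Ps) →
        ∀ (α : BinVar k ℓ → Option Bool) (A : Finset (Fin k)), Extends σ α → Colorable α A →
        extraCount σ α + Qs.length * h ≤ 3 * h → A.card + 2 * Qs.length ≤ 4 →
        ∃ α' A', Extends α α' ∧ A ⊆ A' ∧ Colorable α' A' ∧
          ∀ P ∈ Qs, ∀ x, Agrees x α' → Set.InjOn (blockColor x) (A' : Set (Fin k)) →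
            DNFTrue P x := by
      intro Qs
      induction Qs with
      | nil =>
        intro _ α A _ hα _ _
        exact ⟨α, A, Extends.refl _, Finset.Subset.refl _, hα, by simp⟩
      | cons P Qs ihQ =>
        intro hQ α A hσα hα hexα hAcard
        simp only [List.length_cons, add_mul, one_mul] at hexα hAcard
        suffices ∃ α₁ A₁, Extends α α₁ ∧ A ⊆ A₁ ∧ Colorable α₁ A₁ ∧
            extraCount σ α₁ ≤ extraCount σ α + h ∧ A₁.card ≤ A.card + 2 ∧
            ∀ x, Agrees x α₁ → Set.InjOn (blockColor x) (A₁ : Set (Fin k)) → DNFTrue P x by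
          obtain ⟨α₁, A₁, h1, h2, h3, h4, h5, h6⟩ := this
          obtain ⟨α', A', g1, g2, g3, g4⟩ := ihQ (fun R hR => hQ R (List.mem_cons_of_mem _ hR))
            α₁ A₁ (hσα.trans h1) h3 (by omega) (by omega)
          refine ⟨α', A', h1.trans g1, h2.trans g2, g3, fun R hR x hx hinj => ?_⟩
          rcases List.mem_cons.1 hR with rfl | hR
          · exact h6 x (hx.of_extends g1) (hinj.mono (Finset.coe_subset.2 g2))
          · exact g4 R hR x hx hinj
        rcases hPs P (hQ P List.mem_cons_self) with ⟨C, hC, rfl⟩ | hP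
        · obtain ⟨i, j, hij⟩ := hF C hC
          have hex3 : extraCount σ α ≤ 3 * h := by omega
          have hcol' := hinsert (hinsert hα (by omega) hex3 j)
            ((Finset.card_insert_le _ _).trans (by omega)) hex3 i
          refine ⟨α, insert i (insert j A), Extends.refl _,
            (Finset.subset_insert _ _).trans (Finset.subset_insert _ _), hcol', by omega,
            (Finset.card_insert_le _ _).trans (Nat.succ_le_succ (Finset.card_insert_le _ _)),
            fun x hx hinj => hij x (hx.of_extends hσα) (hinj.mono ?_)⟩
          intro c hc
          rcases hc with rfl | hc <;> simp_all
        · obtain ⟨α', τ', h1, h2, h3, h4, h5, h6, h7⟩ :=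
            (hdec P (List.mem_cons_of_mem _ hP)).exists_branch (E := 3 * h) hσ hℓ hrk hrℓ hE hσα hα
              (by omega) (by omega)
          refine ⟨α', A, h1, Finset.Subset.refl _, h2, h3, by omega, fun x hx _ => ?_⟩
          rw [extraCount_self] at h6
          -- On the path `τ'`, with at most `h` bits beyond `σ`, the premise is constant; the
          -- induction hypothesis rules out that it is constantly false.
          rcases h7 with h7 | h7
          · exact h7 x (hx.of_extends h5)
          · exact absurd h7
              (ih P hP τ' h4 (h2.mono h5 (Finset.empty_subset _)) (by omega))
    have hlen := hD.length_le
    have hmul : Ps.length * h ≤ 2 * h := Nat.mul_le_mul_right h hlen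
    obtain ⟨α', A', h1, -, ⟨x, hx, hinj⟩, h4⟩ :=
      hprem Ps (fun _ hP => hP) τ ∅ hτ hcol (by omega) (by simp; omega)
    exact hfalse x (hx.of_extends h1) (hD.sound fun P hP =>
      h4 P hP x hx (hinj.mono (Finset.coe_subset.2 Finset.subset_union_left)))

/-! ### The colour graph -/

/-- The number of ones in the binary expansion of a vertex. -/
def vertexWeight {ℓ : ℕ} (a : Fin (2 ^ ℓ)) : ℕ :=
  (Finset.univ.filter fun j : Fin ℓ => Nat.testBit a.val j.val = true).card

/-- Vertices of distinct blocks are adjacent if their weights differ modulo `k - 1`. -/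
def colorGraph (k ℓ : ℕ) : SimpleGraph (Fin k × Fin (2 ^ ℓ)) where
  Adj u v := u.1 ≠ v.1 ∧ vertexWeight u.2 % (k - 1) ≠ vertexWeight v.2 % (k - 1)
  symm := ⟨fun _ _ h => ⟨h.1.symm, h.2.symm⟩⟩
  loopless := ⟨fun _ h => h.1 rfl⟩

theorem colorGraph_le (k ℓ : ℕ) :
    colorGraph k ℓ ≤ SimpleGraph.completeEquipartiteGraph k (2 ^ ℓ) :=
  fun _ _ h => h.1

theorem colorGraph_cliqueFree {k ℓ : ℕ} (hk : 2 ≤ k) : (colorGraph k ℓ).CliqueFree k := by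
  intro S hS
  have hcard : (S.image fun u => vertexWeight u.2 % (k - 1)).card = k := by
    rw [Finset.card_image_of_injOn, hS.card_eq]
    intro u hu v hv huv
    by_contra hne
    exact (hS.isClique hu hv hne).2 huv
  have hsub : (S.image fun u => vertexWeight u.2 % (k - 1)) ⊆ Finset.range (k - 1) := by
    intro c hc
    obtain ⟨u, -, rfl⟩ := Finset.mem_image.1 hc
    exact Finset.mem_range.2 (Nat.mod_lt _ (by omega))
  have := Finset.card_le_card hsub
  rw [hcard, Finset.card_range] at this
  omega

/-- Falsifying an axiom means choosing precisely the nonadjacent vertices `a` and `b` in blocks `i`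
and `j`, which then have the same colour. -/
theorem dnfTrue_of_mem_restrictCNF {k ℓ : ℕ} {ρ : BinVar k ℓ → Option Bool}
    {C : Clause (BinVar k ℓ)} (hC : C ∈ restrictCNF (binClique (colorGraph k ℓ)) ρ) :
    ∃ i j : Fin k, ∀ x, Agrees x ρ → Set.InjOn (blockColor x) {i, j} → DNFTrue C.toDNF x := by
  obtain ⟨-, ⟨i, j, a, b, hij, hadj, rfl⟩, hsat, rfl⟩ := hC
  refine ⟨i, j, fun x hx hinj => ?_⟩
  by_contra hfalse
  rw [Clause.toDNF, dnfTrue_toDNF] at hfalse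
  push Not at hfalse
  have hall : ∀ l ∈ notVertex i a ∪ notVertex j b, x l.1 ≠ l.2 := by
    intro l hl
    rcases hρ : ρ l.1 with _ | c
    · exact hfalse l (Finset.mem_filter.2 ⟨hl, hρ⟩)
    · rw [hx _ _ hρ]
      rintro rfl
      exact hsat l hl hρ
  have hcolor : ∀ (c : Fin k) (u : Fin (2 ^ ℓ)), (∀ l ∈ notVertex c u, x l.1 ≠ l.2) →
      blockColor x c = vertexWeight u % (k - 1) := by
    intro c u h
    have hbit : ∀ t : Fin ℓ, x (c, t) = Nat.testBit u.val t.val := by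
      intro t
      have := h ((c, t), !(Nat.testBit u.val t.val))
        (Finset.mem_image_of_mem _ (Finset.mem_univ t))
      simpa using this
    simp only [blockColor, vertexWeight, hbit]
  have hi := hcolor i a fun l hl => hall l (Finset.mem_union_left _ hl)
  have hj := hcolor j b fun l hl => hall l (Finset.mem_union_right _ hl)
  refine hadj ⟨hij, fun e => hij (hinj (by simp) (by simp) ?_)⟩
  rw [hi, hj]
  exact e

/-- Each of the two blocks of an axiom keeps at least three quarters of its bits, and `3 * ℓ / 2 ≥ ℓ
+ 1/2` leaves at least `ℓ + 1` variables after rounding, for `ℓ ≥ 2`. -/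
theorem le_card_of_mem_restrictCNF {k ℓ : ℕ} {G : SimpleGraph (Fin k × Fin (2 ^ ℓ))}
    {ρ : BinVar k ℓ → Option Bool} {C : Clause (BinVar k ℓ)} (hℓ : 2 ≤ ℓ)
    (hρ : ∀ b, 4 * blockCount ρ b ≤ ℓ) (hC : C ∈ restrictCNF (binClique G) ρ) :
    ℓ + 1 ≤ (C.image Prod.fst).card := by
  obtain ⟨-, ⟨i, j, a, b, hij, -, rfl⟩, -, rfl⟩ := hC
  set f : Fin k → Finset (BinVar k ℓ) := fun c =>
    (Finset.univ.filter fun t : Fin ℓ => ρ (c, t) = none).image (Prod.mk c) with hf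
  have hcard : ∀ c, (f c).card + blockCount ρ c = ℓ := by
    intro c
    rw [Finset.card_image_of_injective _ (Prod.mk_right_injective c)]
    have := Finset.card_filter_add_card_filter_not (s := (Finset.univ : Finset (Fin ℓ)))
      fun t => ρ (c, t) = none
    rwa [Finset.card_univ, Fintype.card_fin] at this
  have hdis : Disjoint (f i) (f j) := by
    refine Finset.disjoint_left.2 fun v hv hv' => hij ?_
    obtain ⟨t, -, rfl⟩ := Finset.mem_image.1 hv
    obtain ⟨u, -, hu⟩ := Finset.mem_image.1 hv'
    exact (congrArg Prod.fst hu).symm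
  have hsub : f i ∪ f j ⊆ ((notVertex i a ∪ notVertex j b).filter fun l => ρ l.1 = none).image
      Prod.fst := by
    have hmem : ∀ (c : Fin k) (u : Fin (2 ^ ℓ)),
        f c ⊆ ((notVertex c u).filter fun l => ρ l.1 = none).image Prod.fst := by
      intro c u v hv
      obtain ⟨t, ht, rfl⟩ := Finset.mem_image.1 hv
      refine Finset.mem_image.2 ⟨((c, t), !(Nat.testBit u.val t.val)), Finset.mem_filter.2
        ⟨Finset.mem_image_of_mem _ (Finset.mem_univ t), (Finset.mem_filter.1 ht).2⟩, rfl⟩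
    refine Finset.union_subset ((hmem i a).trans ?_) ((hmem j b).trans ?_)
    · exact Finset.image_subset_image (Finset.filter_subset_filter _ Finset.subset_union_left)
    · exact Finset.image_subset_image (Finset.filter_subset_filter _ Finset.subset_union_right)
  have h1 := Finset.card_le_card hsub
  rw [Finset.card_union_of_disjoint hdis] at h1
  have h2 := hcard i
  have h3 := hcard j
  have h4 := hρ i
  have h5 := hρ j
  omega

/-! ### Refutations of CNFs with wide clauses are long -/

/-- Every rule has at most two premises, so the derivation uses at most twice as many axioms as it
has lines, and these already imply all its lines. -/
theorem ResDerivation.exists_axioms {V : Type} [DecidableEq V] {s : ℕ} {F : Set (Clause V)}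
    {π : List (DNF V)} (h : ResDerivation s F π) :
    ∃ 𝒜 : Finset (Clause V), (∀ C ∈ 𝒜, C ∈ F) ∧ 𝒜.card ≤ 2 * π.length ∧
      ∀ x, (∀ C ∈ 𝒜, DNFTrue C.toDNF x) → ∀ D ∈ π, DNFTrue D x := by
  classical
  induction h with
  | nil => exact ⟨∅, by simp⟩
  | cons π Ps D hπ hPs hD ih =>
    obtain ⟨𝒜, h1, h2, h3⟩ := ih
    have hch : ∀ P : DNF V, ∃ C : Clause V, (∃ C ∈ F, P = C.toDNF) → C ∈ F ∧ P = C.toDNF := by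
      intro P
      by_cases hP : ∃ C ∈ F, P = C.toDNF
      · exact ⟨hP.choose, fun _ => hP.choose_spec⟩
      · exact ⟨∅, fun h => absurd h hP⟩
    choose f hf using hch
    refine ⟨𝒜 ∪ (Ps.toFinset.filter fun P => ∃ C ∈ F, P = C.toDNF).image f, ?_, ?_, ?_⟩
    · intro C hC
      rcases Finset.mem_union.1 hC with hC | hC
      · exact h1 C hC
      · obtain ⟨P, hP, rfl⟩ := Finset.mem_image.1 hC
        exact (hf P (Finset.mem_filter.1 hP).2).1
    · refine (Finset.card_union_le _ _).trans ?_
      have := (Finset.card_image_le (f := f)).trans ((Finset.card_filter_le Ps.toFinset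
        fun P => ∃ C ∈ F, P = C.toDNF).trans ((List.toFinset_card_le Ps).trans hD.length_le))
      rw [List.length_cons]
      omega
    · intro x hx
      have hπx := h3 x fun C hC => hx C (Finset.mem_union_left _ hC)
      refine List.forall_mem_cons.2 ⟨hD.sound fun P hP => ?_, hπx⟩
      rcases hPs P hP with hax | hP'
      · rw [(hf P hax).2]
        exact hx _ (Finset.mem_union_right _ (Finset.mem_image_of_mem _
          (Finset.mem_filter.2 ⟨List.mem_toFinset.2 hP, hax⟩)))
      · exact hπx P hP'

theorem card_falsifying_le {V : Type} [Fintype V] [DecidableEq V] (C : Clause V) :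
    (Finset.univ.filter fun x : V → Bool => ∀ l ∈ C, x l.1 ≠ l.2).card *
      2 ^ (C.image Prod.fst).card ≤ 2 ^ Fintype.card V := by
  rcases (Finset.univ.filter fun x : V → Bool => ∀ l ∈ C, x l.1 ≠ l.2).eq_empty_or_nonempty
    with he | ⟨y, hy⟩
  · rw [he, Finset.card_empty, zero_mul]; exact Nat.zero_le _
  have hy := (Finset.mem_filter.1 hy).2
  set W := C.image Prod.fst with hW
  have hsub : (Finset.univ.filter fun x : V → Bool => ∀ l ∈ C, x l.1 ≠ l.2) ⊆
      Fintype.piFinset fun v => if v ∈ W then {y v} else Finset.univ := by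
    intro x hx
    have hx := (Finset.mem_filter.1 hx).2
    refine Fintype.mem_piFinset.2 fun v => ?_
    split_ifs with hv
    · obtain ⟨l, hl, rfl⟩ := Finset.mem_image.1 hv
      have h1 := hx l hl
      have h2 := hy l hl
      rw [Finset.mem_singleton]
      revert h1 h2
      cases x l.1 <;> cases y l.1 <;> cases l.2 <;> simp
    · simp
  have hcard : (Fintype.piFinset fun v => if v ∈ W then {y v} else Finset.univ).card =
      2 ^ (Wᶜ).card := by
    rw [Fintype.card_piFinset]
    have : ∀ v, (if v ∈ W then {y v} else (Finset.univ : Finset Bool)).card =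
        if v ∈ Wᶜ then 2 else 1 := by
      intro v
      by_cases hv : v ∈ W <;> simp [hv]
    simp only [this]
    rw [Finset.prod_ite_mem, Finset.univ_inter, Finset.prod_const]
  refine (Nat.mul_le_mul_right _ ((Finset.card_le_card hsub).trans hcard.le)).trans ?_
  rw [← pow_add, Finset.card_compl_add_card]

/-- A clause on at least `w` variables is falsified by at most a `2 ^ (-w)` fraction of the
assignments. Fewer than `2 ^ w` axioms are therefore simultaneously satisfiable and cannot yield the
empty clause. -/
theorem IsResRefutation.two_pow_le {V : Type} [Fintype V] [DecidableEq V] {s w : ℕ}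
    {F : Set (Clause V)} {π : List (DNF V)} (hw : 0 < w)
    (hF : ∀ C ∈ F, w ≤ (C.image Prod.fst).card) (h : IsResRefutation s F π) :
    2 ^ w ≤ 2 * π.length := by
  classical
  by_contra! hlt
  obtain ⟨hπ, h | h⟩ := h
  · simpa using hw.trans_le (hF ∅ h)
  obtain ⟨𝒜, h1, h2, h3⟩ := hπ.exists_axioms
  have hbad : ((𝒜.biUnion fun C =>
      Finset.univ.filter fun x : V → Bool => ∀ l ∈ C, x l.1 ≠ l.2).card) < 2 ^ Fintype.card V := by
    refine lt_of_mul_lt_mul_right (a := 2 ^ w) ?_ (Nat.zero_le _)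
    calc _ ≤ (∑ C ∈ 𝒜, (Finset.univ.filter fun x : V → Bool => ∀ l ∈ C, x l.1 ≠ l.2).card) *
          2 ^ w := Nat.mul_le_mul_right _ Finset.card_biUnion_le
      _ ≤ ∑ C ∈ 𝒜, 2 ^ Fintype.card V := by
          rw [Finset.sum_mul]
          refine Finset.sum_le_sum fun C hC => ?_
          exact (Nat.mul_le_mul_left _ (Nat.pow_le_pow_right (by norm_num) (hF C (h1 C hC)))).trans
            (card_falsifying_le C)
      _ = 𝒜.card * 2 ^ Fintype.card V := by rw [Finset.sum_const, smul_eq_mul]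
      _ < 2 ^ w * 2 ^ Fintype.card V :=
          Nat.mul_lt_mul_of_pos_right (h2.trans_lt hlt) (by positivity)
      _ = _ := mul_comm _ _
  have hne : (𝒜.biUnion fun C =>
      Finset.univ.filter fun x : V → Bool => ∀ l ∈ C, x l.1 ≠ l.2) ≠ Finset.univ := by
    intro he
    rw [he, Finset.card_univ, Fintype.card_fun, Fintype.card_bool] at hbad
    exact hbad.false
  obtain ⟨x, hx⟩ : ∃ x : V → Bool, x ∉ 𝒜.biUnion fun C =>
      Finset.univ.filter fun x : V → Bool => ∀ l ∈ C, x l.1 ≠ l.2 := by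
    by_contra! hall
    exact hne (Finset.eq_univ_iff_forall.2 hall)
  refine not_dnfTrue_empty x (h3 x (fun C hC => ?_) ∅ h)
  rw [Clause.toDNF, dnfTrue_toDNF]
  by_contra! hno
  exact hx (Finset.mem_biUnion.2 ⟨C, hC, Finset.mem_filter.2 ⟨Finset.mem_univ x, hno⟩⟩)

/-! ### The lower bound -/

theorem four_pow_le_de {s : ℕ} (hs : 1 ≤ s) : 4 ^ s ≤ de s := by
  have h1 : 4 ^ s ≤ pe s := by
    rw [pe, show (4 : ℕ) = 2 ^ 2 by norm_num, ← pow_mul]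
    exact Nat.pow_le_pow_right (by norm_num) (by nlinarith)
  have h2 : pe s ≤ pe s * s := Nat.le_mul_of_pos_right _ hs
  exact (h1.trans h2).trans (Nat.le_self_pow (by omega) _)

theorem de_pos {s : ℕ} (hs : 1 ≤ s) : 0 < de s :=
  (show 0 < 4 ^ s by positivity).trans_le (four_pow_le_de hs)

/-- With `a = s * pe s ≥ 2 * s`, Bernoulli's inequality gives `(a / (1 + a)) ^ s ≥ 1 - s / (1 + a) ≥
1 / 2`. This turns the depth from the switching lemma into a multiple of `de s`. -/
theorem one_add_mul_pe_pow_le {s : ℕ} (hs : 1 ≤ s) : (1 + s * pe s) ^ s ≤ 2 * de s := by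
  have hpe : 2 ≤ pe s := by
    rw [pe]
    exact Nat.le_self_pow (by positivity) 2
  set a : ℝ := (s : ℝ) * pe s with ha
  have hsa : 2 * (s : ℝ) ≤ a := by
    have h1 : (2 : ℝ) ≤ pe s := by exact_mod_cast hpe
    have h2 : (0 : ℝ) ≤ s := by positivity
    nlinarith
  have ha0 : 0 < 1 + a := by positivity
  have hbern := one_add_mul_le_pow (a := -(1 / (1 + a)))
    (by
      have : 1 / (1 + a) ≤ 1 := by rw [div_le_one ha0]; have : 0 ≤ a := by positivity
                                   linarith
      linarith) s
  have h1 : (s : ℝ) * (1 / (1 + a)) ≤ 1 / 2 := by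
    rw [mul_one_div, div_le_div_iff₀ ha0 (by norm_num)]; linarith
  have h2 : 1 + -(1 / (1 + a)) = a / (1 + a) := by field_simp; ring
  rw [h2, div_pow] at hbern
  have h3 : (1 : ℝ) / 2 ≤ a ^ s / (1 + a) ^ s := by linarith
  rw [div_le_div_iff₀ (by norm_num) (by positivity)] at h3
  have h4 : ((1 + s * pe s) ^ s : ℝ) ≤ 2 * ((pe s : ℝ) * s) ^ s := by
    rw [mul_comm (pe s : ℝ)]; linarith
  rw [de]
  exact_mod_cast h4

/-- With `t = ℓ / 2 ^ (s + 2)` the numerator is at most `exp t` and the denominator is `exp (2 * t *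
log 2)`. Since `2 * log 2 - 1 > 1 / 3`, it remains to see `4 * ℓ < exp (t / 3)`, which holds because
`t ^ 2` exceeds a large multiple of `ℓ`. -/
theorem fewBits_of_le {k ℓ s : ℕ} (hs : 1 ≤ s) (hkℓ : k ≤ ℓ) (hk : 18432 * de s ≤ k) :
    FewBits k ℓ s := by
  set t : ℝ := (ℓ : ℝ) / 2 ^ (s + 2) with ht
  have ht0 : 0 ≤ t := by positivity
  have h4 : (18432 : ℝ) * (2 ^ s) ^ 2 ≤ ℓ := by
    have h1 : 18432 * 4 ^ s ≤ ℓ :=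
      ((Nat.mul_le_mul_left _ (four_pow_le_de hs)).trans hk).trans hkℓ
    rw [← pow_mul, mul_comm s 2, pow_mul]
    norm_num
    exact_mod_cast h1
  have h2s : (0 : ℝ) < 2 ^ s := by positivity
  have hℓ : (0 : ℝ) < ℓ := lt_of_lt_of_le (by positivity) h4
  have hlarge : 4 * (ℓ : ℝ) < Real.exp (t / 3) := by
    have h1 := Real.quadratic_le_exp_of_nonneg (show 0 ≤ t / 3 by positivity)
    have h2 : 4 * (ℓ : ℝ) < (t / 3) ^ 2 / 2 := by
      rw [ht, div_div, div_pow, div_div, lt_div_iff₀ (by positivity), pow_add]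
      nlinarith [mul_le_mul_of_nonneg_left h4 hℓ.le, mul_pos hℓ (pow_pos h2s 2)]
    linarith
  have hnum : (1 + 1 / 2 ^ (s + 2) : ℝ) ^ ℓ ≤ Real.exp t := by
    have h1 : (1 + 1 / 2 ^ (s + 2) : ℝ) ≤ Real.exp (1 / 2 ^ (s + 2)) := by
      rw [add_comm]; exact Real.add_one_le_exp _
    refine (pow_le_pow_left₀ (by positivity) h1 ℓ).trans_eq ?_
    rw [← Real.exp_nat_mul, ht]
    ring_nf
  have hden : (2 : ℝ) ^ ((ℓ : ℝ) / 2 ^ (s + 1)) = Real.exp (Real.log 2 * (2 * t)) := by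
    rw [Real.rpow_def_of_pos (by norm_num)]
    congr 2
    rw [ht, pow_succ _ (s + 1)]
    field_simp
  unfold FewBits
  rw [hden, ← mul_div_assoc, div_lt_iff₀ (Real.exp_pos _)]
  have hk' : (k : ℝ) ≤ ℓ := by exact_mod_cast hkℓ
  have hexp : Real.exp (t / 3) * Real.exp t ≤ Real.exp (Real.log 2 * (2 * t)) := by
    rw [← Real.exp_add, Real.exp_le_exp]
    have := Real.log_two_gt_d9
    nlinarith
  calc (k : ℝ) * (1 + 1 / 2 ^ (s + 2)) ^ ℓ ≤ ℓ * Real.exp t := by gcongr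
    _ < Real.exp (t / 3) / 4 * Real.exp t := by
        gcongr
        linarith
    _ ≤ _ := by linarith

/-! ### Combining switching, adversary and the counting bound -/

theorem not_isResRefutation_of_decDepth {k ℓ s r h : ℕ} {ρ σ : BinVar k ℓ → Option Bool}
    (hρσ : Extends ρ σ) (hρ : ∀ b, 4 * blockCount ρ b ≤ ℓ) (hσ : ∀ b, 2 * blockCount σ b ≤ ℓ)
    (hℓ : 2 ≤ ℓ) (hrk : r < k - 1) (hrℓ : 4 * r ≤ ℓ) (hE : 4 * (3 * h) + 4 * ℓ ≤ r * ℓ)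
    {π : List (DNF (BinVar k ℓ))}
    (hπ : IsResRefutation s (restrictCNF (binClique (colorGraph k ℓ)) ρ) π)
    (hdec : ∀ D ∈ π, DecDepth h σ (DNFTrue D)) : False := by
  obtain ⟨hder, hem | hem⟩ := hπ
  · have := le_card_of_mem_restrictCNF hℓ hρ hem
    simp at this
  refine hder.not_falsified hσ (by omega) hrk hrℓ hE (fun C hC => ?_) hdec ∅ hem σ
    (Extends.refl σ) ?_ (by rw [extraCount_self]; exact Nat.zero_le _)
    fun x _ => not_dnfTrue_empty x
  · obtain ⟨i, j, hij⟩ := dnfTrue_of_mem_restrictCNF hC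
    exact ⟨i, j, fun x hx => hij x (hx.of_extends hρσ)⟩
  · obtain ⟨x, hx⟩ := exists_agrees σ
    have hheavy : heavyBlocks σ = ∅ := by
      refine Finset.filter_eq_empty_iff.2 fun b _ hb => ?_
      have := hσ b
      omega
    exact ⟨x, hx, by simp [hheavy]⟩

theorem sizeBound_eq_two_rpow (k ℓ s : ℕ) :
    sizeBound (2 ^ ℓ) k s = (2 : ℝ) ^ ((ℓ : ℝ) * ((k : ℝ) - 1) / (18432 * (de s : ℝ))) := by
  rw [sizeBound]
  push_cast
  rw [← Real.rpow_natCast, ← Real.rpow_mul (by norm_num)]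
  congr 1
  rw [div_eq_mul_inv, div_eq_mul_inv _ (18432 * (de s : ℝ)), mul_inv]
  ring

theorem sizeBound_le_length {k ℓ s : ℕ} (hs : 1 ≤ s) (hk : 2 ≤ k) (hkℓ : k ≤ ℓ)
    {ρ : BinVar k ℓ → Option Bool} (hρ : ∀ b, (blockCount ρ b : ℝ) ≤ (ℓ : ℝ) / 2 ^ (s + 1))
    {π : List (DNF (BinVar k ℓ))}
    (hπ : IsResRefutation s (restrictCNF (binClique (colorGraph k ℓ)) ρ) π) :
    sizeBound (2 ^ ℓ) k s ≤ (π.length : ℝ) := by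
  have hde := de_pos hs
  have hde' : (0 : ℝ) < de s := by exact_mod_cast hde
  have hℓ2 : 2 ≤ ℓ := hk.trans hkℓ
  have hℓ' : (0 : ℝ) < ℓ := by exact_mod_cast (show 0 < ℓ by omega)
  have hρ4 : ∀ b, 4 * blockCount ρ b ≤ ℓ := by
    intro b
    have h1 : (ℓ : ℝ) / 2 ^ (s + 1) ≤ ℓ / 4 := by
      refine div_le_div_of_nonneg_left hℓ'.le (by norm_num) ?_
      calc (4 : ℝ) = 2 ^ 2 := by norm_num
        _ ≤ 2 ^ (s + 1) := pow_le_pow_right₀ (by norm_num) (by omega)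
    have h2 : (4 : ℝ) * blockCount ρ b ≤ ℓ := by linarith [hρ b]
    exact_mod_cast h2
  rw [sizeBound_eq_two_rpow]
  set X : ℝ := (ℓ : ℝ) * ((k : ℝ) - 1) / (18432 * (de s : ℝ)) with hX
  -- Here `18432 = 2 * 96 ^ 2`. In the small case the exponent `X` is at most `ℓ`, and the axioms,
  -- having at least `ℓ + 1` variables, give length at least `2 ^ ℓ`.
  by_cases hsmall : k - 1 ≤ 18432 * de s
  · have h1 := hπ.two_pow_le (Nat.succ_pos ℓ) fun C hC => le_card_of_mem_restrictCNF hℓ2 hρ4 hC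
    rw [pow_succ, mul_comm] at h1
    have h2 : (2 : ℝ) ^ ℓ ≤ π.length := by
      exact_mod_cast (show 2 ^ ℓ ≤ π.length by omega)
    refine le_trans ?_ h2
    rw [← Real.rpow_natCast]
    refine Real.rpow_le_rpow_of_exponent_le (by norm_num) ?_
    rw [hX, div_le_iff₀ (by positivity)]
    have h3 : (k : ℝ) - 1 ≤ 18432 * de s := by
      have : (k : ℝ) ≤ 18432 * de s + 1 := by exact_mod_cast (show k ≤ 18432 * de s + 1 by omega)
      linarith
    exact mul_le_mul_of_nonneg_left h3 hℓ'.le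
  by_contra! hlt
  have hbig : 18432 * de s ≤ k - 1 := by omega
  obtain ⟨K, rfl⟩ : ∃ K, k = K + 1 := ⟨k - 1, by omega⟩
  rw [Nat.add_sub_cancel] at hbig
  have hbig' : (18432 : ℝ) * de s ≤ K := by exact_mod_cast hbig
  push_cast at hX
  rw [add_sub_cancel_right] at hX
  have hX1 : 1 ≤ X := by
    rw [hX, one_le_div (by positivity)]
    have : (1 : ℝ) ≤ ℓ := by exact_mod_cast (show 1 ≤ ℓ by omega)
    nlinarith [mul_pos hde' hde']
  set L := ⌈X⌉₊ with hL
  have hLX : X ≤ L := Nat.le_ceil X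
  have hL2 : (L : ℝ) ≤ 2 * X := by
    have := Nat.ceil_lt_add_one (show 0 ≤ X by linarith)
    linarith
  have hL1 : 1 ≤ L := by exact_mod_cast hX1.trans hLX
  have hcard : π.toFinset.card ≤ 2 ^ L := by
    refine (List.toFinset_card_le π).trans ?_
    have : (π.length : ℝ) ≤ 2 ^ L := by
      rw [← Real.rpow_natCast]
      exact hlt.le.trans (Real.rpow_le_rpow_of_exponent_le (by norm_num) hLX)
    exact_mod_cast this
  obtain ⟨σ, hρσ, hσ, hdec⟩ := exists_restriction_decDepth
    (fewBits_of_le hs hkℓ (hbig.trans (Nat.le_succ K))) le_rfl hL1 ρ π.toFinset hcard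
    fun D hD => hπ.1.card_le hs D (List.mem_toFinset.1 hD)
  have hσ2 : ∀ b, 2 * blockCount σ b ≤ ℓ := by
    intro b
    -- The given `ρ` and the `s` rounds each set at most `ℓ / 2 ^ (s + 1)` bits of a block.
    have h1 : ((s : ℝ) + 1) * (ℓ / 2 ^ (s + 1)) ≤ ℓ / 2 := by
      have h2 : (s : ℝ) + 1 ≤ 2 ^ s := by exact_mod_cast Nat.lt_two_pow_self (n := s)
      rw [pow_succ, ← mul_div_assoc, div_le_div_iff₀ (by positivity) (by norm_num)]
      nlinarith [mul_le_mul_of_nonneg_right h2 hℓ'.le]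
    have h2 : (2 : ℝ) * blockCount σ b ≤ ℓ := by linarith [hσ b, hρ b]
    exact_mod_cast h2
  have hLnat : L * (18432 * de s) ≤ 2 * (ℓ * K) := by
    have h1 : X * (18432 * de s) = ℓ * K := by rw [hX]; field_simp
    have h2 : (L : ℝ) * (18432 * de s) ≤ 2 * (ℓ * K) := by
      calc (L : ℝ) * (18432 * de s) ≤ 2 * X * (18432 * de s) := by gcongr
        _ = 2 * (ℓ * K) := by rw [mul_assoc, h1]
    exact_mod_cast h2
  have hdepth : L * (1 + s * pe s) ^ s - L ≤ 2 * (L * de s) :=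
    (Nat.sub_le _ _).trans ((Nat.mul_le_mul_left L (one_add_mul_pe_pow_le hs)).trans_eq (by ring))
  -- The choice `r = K / 4` with `K = k - 1 ≤ ℓ` meets `r < k - 1` and `4 * r ≤ ℓ`. Since `h` is at
  -- most `4 * ℓ * K / 18432` and `K ≥ 18432`, the budget `12 * h + 4 * ℓ` stays far below `r * ℓ`.
  refine not_isResRefutation_of_decDepth (r := K / 4) hρσ hρ4 hσ2 hℓ2 (by omega) (by omega) ?_ hπ
    fun D hD => hdec D (List.mem_toFinset.2 hD)
  set h := L * (1 + s * pe s) ^ s - L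
  have hK : 18432 ≤ K := (Nat.le_mul_of_pos_right _ hde).trans hbig
  have h1 : 18432 * h ≤ 4 * (ℓ * K) := by
    calc 18432 * h ≤ 18432 * (2 * (L * de s)) := Nat.mul_le_mul_left _ hdepth
      _ = 2 * (L * (18432 * de s)) := by ring
      _ ≤ _ := by omega
  have h2 : ℓ * K ≤ 8 * (K / 4 * ℓ) := by
    calc ℓ * K ≤ ℓ * (8 * (K / 4)) := Nat.mul_le_mul_left _ (by omega)
      _ = _ := by ring
  have h3 : ℓ * 18432 ≤ ℓ * K := Nat.mul_le_mul_left _ hK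
  omega

theorem cliqueProperty_colorGraph {k ℓ s : ℕ} (hs : 1 ≤ s) (hk : 2 ≤ k) (hkℓ : k ≤ ℓ) :
    CliqueProperty (colorGraph k ℓ) s := by
  intro ρ hρ π hπ
  refine sizeBound_le_length hs hk hkℓ (fun b => ?_) hπ
  have h1 : blockCount ρ b = ⌊(1 / 2 ^ (s + 1) : ℝ) * ℓ⌋₊ := hρ b
  rw [h1]
  refine (Nat.floor_le (by positivity)).trans_eq (by ring)

theorem restrictCNF_none {V : Type} (F : Set (Clause V)) : restrictCNF F (fun _ => none) = F := by
  ext C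
  simp [restrictCNF]

theorem sizeBound_le_length_binClique {k ℓ s : ℕ} (hs : 1 ≤ s) (hk : 2 ≤ k) (hkℓ : k ≤ ℓ)
    {π : List (DNF (BinVar k ℓ))} (hπ : IsResRefutation s (binClique (colorGraph k ℓ)) π) :
    sizeBound (2 ^ ℓ) k s ≤ (π.length : ℝ) := by
  rw [← restrictCNF_none (binClique (colorGraph k ℓ))] at hπ
  refine sizeBound_le_length hs hk hkℓ (fun b => ?_) hπ
  simp only [blockCount, ne_eq, not_true_eq_false, Finset.filter_false, Finset.card_empty,
    Nat.cast_zero]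
  positivity

/-! ### Random block graphs -/

/-- The edge set of `G` is one outcome mapped to `G`, and its mass is a product of powers of `p` and
`1 - p`. -/
theorem randomBlockGraph_singleton_pos {k n : ℕ} {p : unitInterval} (hp₀ : 0 < (p : ℝ))
    (hp₁ : (p : ℝ) < 1) {G : SimpleGraph (Fin k × Fin n)}
    (hG : G ≤ SimpleGraph.completeEquipartiteGraph k n) : 0 < randomBlockGraph k n p {G} := by
  have hmeas : Measurable
      (SimpleGraph.fromEdgeSet : Set (Sym2 (Fin k × Fin n)) → SimpleGraph (Fin k × Fin n)) :=
    Measurable.of_discrete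
  refine lt_of_lt_of_le ?_ (MeasureTheory.Measure.le_map_apply hmeas.aemeasurable _)
  refine lt_of_lt_of_le ?_ (MeasureTheory.measure_mono
    (Set.singleton_subset_iff.2 (SimpleGraph.fromEdgeSet_edgeSet G)))
  rw [ProbabilityTheory.setBernoulli_singleton p (SimpleGraph.edgeSet_mono hG) (Set.toFinite _)]
  refine ENNReal.mul_pos (pow_ne_zero _ ?_) (pow_ne_zero _ ?_)
  · rw [ENNReal.coe_ne_zero]
    exact fun h => hp₀.ne' (congrArg NNReal.toReal h)
  · rw [ENNReal.coe_ne_zero]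
    intro h
    have := congrArg NNReal.toReal h
    simp at this
    linarith

/-! ### Shape of the bound, fpt consequence and assembly -/

theorem exists_strictMono_sizeBound_eq_pow {s k : ℕ} (hs : 1 ≤ s) (hk : 2 ≤ k) :
    ∃ g : ℕ → ℝ, StrictMono g ∧ ∀ n : ℕ, sizeBound n k s = g n ^ k := by
  have hde : (0 : ℝ) < de s := by exact_mod_cast de_pos hs
  have hk' : (2 : ℝ) ≤ k := by exact_mod_cast hk
  have hexp : 0 < (1 / (2 * 96 ^ 2) : ℝ) * ((k : ℝ) - 1) / (de s : ℝ) :=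
    div_pos (mul_pos (by norm_num) (by linarith)) hde
  refine ⟨fun n => (n : ℝ) ^ ((1 / (2 * 96 ^ 2) : ℝ) * ((k : ℝ) - 1) / (de s : ℝ) / k),
    fun m n hmn => ?_, fun n => ?_⟩
  · exact Real.rpow_lt_rpow (by positivity) (by exact_mod_cast hmn)
      (div_pos hexp (by linarith))
  · rw [← Real.rpow_natCast, ← Real.rpow_mul (by positivity), div_mul_cancel₀ _ (by linarith),
      sizeBound]

theorem exists_graph_fpt_lower_bound {s : ℕ} (hs : 1 ≤ s) (f : ℕ → ℕ) (d : ℝ) :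
    ∃ k : ℕ, 2 ≤ k ∧ ∀ᶠ ℓ : ℕ in Filter.atTop, ∃ G : SimpleGraph (Fin k × Fin (2 ^ ℓ)),
      G ≤ SimpleGraph.completeEquipartiteGraph k (2 ^ ℓ) ∧ G.CliqueFree k ∧
        ∀ π, IsResRefutation s (binClique G) π →
          (f k : ℝ) * ((2 ^ ℓ : ℕ) : ℝ) ^ d < (π.length : ℝ) := by
  have hde : (0 : ℝ) < de s := by exact_mod_cast de_pos hs
  -- With `k = m + 2` the exponent of `sizeBound` is at least `d + 1`; the spare factor `n` absorbs
  -- `f k` once `ℓ ≥ f k`.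
  obtain ⟨m, hm⟩ := exists_nat_ge ((d + 1) * (2 * 96 ^ 2) * de s)
  refine ⟨m + 2, by omega, ?_⟩
  filter_upwards [Filter.eventually_ge_atTop (m + 2), Filter.eventually_ge_atTop (f (m + 2))]
    with ℓ hℓ hf
  refine ⟨colorGraph (m + 2) ℓ, colorGraph_le _ _, colorGraph_cliqueFree (by omega),
    fun π hπ => lt_of_lt_of_le ?_ (sizeBound_le_length_binClique hs (by omega) hℓ hπ)⟩
  have hn : (1 : ℝ) ≤ ((2 ^ ℓ : ℕ) : ℝ) := by exact_mod_cast Nat.one_le_two_pow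
  have hfn : (f (m + 2) : ℝ) < ((2 ^ ℓ : ℕ) : ℝ) := by
    exact_mod_cast hf.trans_lt Nat.lt_two_pow_self
  calc (f (m + 2) : ℝ) * ((2 ^ ℓ : ℕ) : ℝ) ^ d
      < ((2 ^ ℓ : ℕ) : ℝ) * ((2 ^ ℓ : ℕ) : ℝ) ^ d :=
        mul_lt_mul_of_pos_right hfn (Real.rpow_pos_of_pos (by linarith) _)
    _ = ((2 ^ ℓ : ℕ) : ℝ) ^ (d + 1) := by
        rw [Real.rpow_add_one (by linarith), mul_comm]
    _ ≤ _ := by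
        refine Real.rpow_le_rpow_of_exponent_le hn ?_
        rw [le_div_iff₀ hde]
        push_cast
        linarith

theorem mainTheorem1 :
    -- the lower bound, with the explicit exponent and in the form `n ^ (Ω(k) / d(s))`
    (∃ c : ℝ, 0 < c ∧
      ∀ (ε : ℝ) (k s ℓ : ℕ) (p : unitInterval), 0 < ε → ε < 1 → 1 ≤ s → 2 ≤ k →
        (s : ℝ) ≤ ((1 / 5 : ℝ) * Real.logb 2 (Real.logb 2 ((2 ^ ℓ : ℕ) : ℝ))) ^ (1 / 3 : ℝ) →
        (k : ℝ) ≤ Real.logb 2 ((2 ^ ℓ : ℕ) : ℝ) →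
        (p : ℝ) = ((2 ^ ℓ : ℕ) : ℝ) ^ (-((1 + ε) * (2 / ((k : ℝ) - 1)))) →
        0 < randomBlockGraph k (2 ^ ℓ) p
          {G | G ≤ SimpleGraph.completeEquipartiteGraph k (2 ^ ℓ) ∧
            G.CliqueFree k ∧
            CliqueProperty G s ∧
            ∀ π, IsResRefutation s (binClique G) π →
              sizeBound (2 ^ ℓ) k s ≤ (π.length : ℝ) ∧
              ((2 ^ ℓ : ℕ) : ℝ) ^ (c * (k : ℝ) / (de s : ℝ)) ≤ (π.length : ℝ)}) ∧
    -- the bound has the form `g(n) ^ k` with `g` strictly increasing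
    (∀ s k : ℕ, 1 ≤ s → 2 ≤ k →
      ∃ g : ℕ → ℝ, StrictMono g ∧ ∀ n : ℕ, sizeBound n k s = g n ^ k) ∧
    -- no refutations of fpt-size `f(k) n ^ d`
    (∀ (s : ℕ) (f : ℕ → ℕ) (d : ℝ), 1 ≤ s →
      ∃ k : ℕ, 2 ≤ k ∧ ∀ᶠ ℓ : ℕ in Filter.atTop,
        ∃ G : SimpleGraph (Fin k × Fin (2 ^ ℓ)),
          G ≤ SimpleGraph.completeEquipartiteGraph k (2 ^ ℓ) ∧ G.CliqueFree k ∧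
          ∀ π, IsResRefutation s (binClique G) π →
            (f k : ℝ) * ((2 ^ ℓ : ℕ) : ℝ) ^ d < (π.length : ℝ)) := by
  -- Half of `δ` suffices for `c`, because `k / 2 ≤ k - 1` for `k ≥ 2`.
  refine ⟨⟨1 / (4 * 96 ^ 2), by norm_num, ?_⟩, ?_, ?_⟩
  · intro ε k s ℓ p hε _ hs hk _ hkn hp
    have hlog : Real.logb 2 ((2 ^ ℓ : ℕ) : ℝ) = ℓ := by
      push_cast
      rw [Real.logb_pow, Real.logb_self_eq_one (by norm_num), mul_one]
    rw [hlog] at hkn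
    have hkℓ : k ≤ ℓ := by exact_mod_cast hkn
    have hk' : (2 : ℝ) ≤ k := by exact_mod_cast hk
    have hn : (1 : ℝ) < ((2 ^ ℓ : ℕ) : ℝ) := by
      exact_mod_cast Nat.one_lt_two_pow (show ℓ ≠ 0 by omega)
    have hp₀ : 0 < (p : ℝ) := by rw [hp]; exact Real.rpow_pos_of_pos (by linarith) _
    have hp₁ : (p : ℝ) < 1 := by
      rw [hp]
      refine Real.rpow_lt_one_of_one_lt_of_neg hn (neg_neg_of_pos ?_)
      exact mul_pos (by linarith) (div_pos (by norm_num) (by linarith))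
    refine (randomBlockGraph_singleton_pos hp₀ hp₁ (colorGraph_le k ℓ)).trans_le
      (MeasureTheory.measure_mono (Set.singleton_subset_iff.2 ⟨colorGraph_le k ℓ,
        colorGraph_cliqueFree hk, cliqueProperty_colorGraph hs hk hkℓ, fun π hπ => ?_⟩))
    have hπ := sizeBound_le_length_binClique hs hk hkℓ hπ
    refine ⟨hπ, le_trans (Real.rpow_le_rpow_of_exponent_le hn.le ?_) hπ⟩
    refine div_le_div_of_nonneg_right ?_ (Nat.cast_nonneg _)
    linarith
  · exact fun s k hs hk => exists_strictMono_sizeBound_eq_pow hs hk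
  · exact fun s f d hs => exists_graph_fpt_lower_bound hs f d
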